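/- Let $(A,\mathfrak m)$ be a Gorenstein (Noetherian) local ring and let $\mathfrak a$ be an ideal of $A$ such that the associated graded ring $G_{\mathfrak a}(A)=\bigoplus_{n\ge 0}\mathfrak a^n/\mathfrak a^{n+1}$ is Gorenstein. Let $M$ be a (finitely generated) maximal Cohen–Macaulay $A$-module such that the associated graded module $G_{\mathfrak a}(M)=\bigoplus_{n\ge 0}\mathfrak a^nM/\mathfrak a^{n+1}M$ is a Cohen–Macaulay $G_{\mathfrak a}(A)$-module. Let $M^*=\operatorname{Hom}_A(M,A)$, and let $\mathcal F=\{M^*_n\}_{n\in\mathbb Z}$ be the dual filtration of $M^*$ with respect to $\mathfrak a$, where $$M^*_n=\{f\in M^* \mid f(M)\subseteq \mathfrak a^n\},\qquad \mathfrak a^n=A \text{ for } n\le 0 .$$ Let $G(\mathcal F,M^*)=\bigoplus_{n\in\mathbb Z}M^*_n/M^*_{n+1}$ be the associated graded module, which is a graded $G_{\mathfrak a}(A)$-module. For graded modules $X,Y$ over a graded ring $R$ let ${}^*\!\operatorname{Hom}_R(X,Y)=\bigoplus_{n\in\mathbb Z}{}^*\!\operatorname{Hom}_R(X,Y)_n$,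 where ${}^*\!\operatorname{Hom}_R(X,Y)_n$ is the group of $R$-linear maps $\varphi:X\to Y$ with $\varphi(X_j)\subseteq Y_{n+j}$ for all $j$. Then there is an isomorphism of graded $G_{\mathfrak a}(A)$-modules $$G(\mathcal F,M^*)\;\cong\;{}^*\!\operatorname{Hom}_{G_{\mathfrak a}(A)}\bigl(G_{\mathfrak a}(M),G_{\mathfrak a}(A)\bigr).$$ More precisely, the natural map $\Phi_M$ sending the class of $f\in M^*_n$ in $M^*_n/M^*_{n+1}$ to the homogeneous map of degree $n$ given by $m+\mathfrak a^{j+1}M\mapsto f(m)+\mathfrak a^{n+j+1}$ for $m\in\mathfrak a^jM$ is such an isomorphism. -/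

import Mathlib

open scoped DirectSum

universe u v w

/-- An `𝔞`-filtration `(M_n)_{n ∈ ℤ}` of an `A`-module `M`: a decreasing family of submodules with
`M_n = M` for `n ≪ 0` and `𝔞 M_n ⊆ M_{n+1}`. -/
structure IdealFiltration {A : Type u} [CommRing A] (𝔞 : Ideal A)
    (M : Type v) [AddCommGroup M] [Module A M] where
  N : ℤ → Submodule A M
  succ_le : ∀ n, N (n + 1) ≤ N n
  smul_le : ∀ n, 𝔞 • N n ≤ N (n + 1)
  eventually_top : ∃ n₀ : ℤ, ∀ n ≤ n₀, N n = ⊤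

namespace IdealFiltration

section basic

variable {A : Type u} [CommRing A] {𝔞 : Ideal A} {M : Type v} [AddCommGroup M] [Module A M]

theorem antitone (F : IdealFiltration 𝔞 M) : Antitone F.N :=
  antitone_int_of_succ_le F.succ_le

theorem pow_smul_le (F : IdealFiltration 𝔞 M) (i j : ℤ) :
    𝔞 ^ i.toNat • F.N j ≤ F.N (i + j) := by
  have key : ∀ (k : ℕ) (j : ℤ), 𝔞 ^ k • F.N j ≤ F.N (k + j) := by
    intro k
    induction k with
    | zero => intro j; simp
    | succ k ih =>
      intro j
      rw [pow_succ', Submodule.mul_smul]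
      refine (smul_mono_right _ (ih j)).trans ((F.smul_le _).trans (le_of_eq ?_))
      congr 1
      push_cast
      ring
  exact (key i.toNat j).trans (F.antitone (by omega))

variable (𝔞 M) in
/-- The `𝔞`-adic filtration `(𝔞^n M)_{n ∈ ℤ}` of `M`, where `𝔞^n = A` for `n ≤ 0`. -/
def adic : IdealFiltration 𝔞 M where
  N n := 𝔞 ^ n.toNat • (⊤ : Submodule A M)
  succ_le n := Submodule.smul_mono_left (Ideal.pow_le_pow_right (by omega))
  smul_le n := by
    rw [← Submodule.mul_smul, ← pow_succ']
    exact Submodule.smul_mono_left (Ideal.pow_le_pow_right (by omega))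
  eventually_top := ⟨0, fun n hn => by simp [Int.toNat_of_nonpos hn]⟩

theorem mem_adic_self {n : ℤ} {a : A} : a ∈ (adic 𝔞 A).N n ↔ a ∈ 𝔞 ^ n.toNat := by
  simp [adic]

variable (𝔞 M) in
/-- The dual filtration of `M^* = Hom_A(M, A)`: its `n`-th term is `{f | f(M) ⊆ 𝔞^n}`,
where `𝔞^n = A` for `n ≤ 0`. -/
def dual : IdealFiltration 𝔞 (Module.Dual A M) where
  N n :=
    { carrier := {f | ∀ m : M, f m ∈ 𝔞 ^ n.toNat}
      add_mem' := fun hf hg m => Ideal.add_mem _ (hf m) (hg m)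
      zero_mem' := fun _ => Ideal.zero_mem _
      smul_mem' := fun c _ hf m => Ideal.mul_mem_left _ c (hf m) }
  succ_le n := fun f hf m => Ideal.pow_le_pow_right (by omega) (hf m)
  smul_le n := Submodule.smul_le.2 fun a ha f hf m => by
    have h : a * f m ∈ 𝔞 ^ (n.toNat + 1) := by
      rw [pow_succ']
      exact Ideal.mul_mem_mul ha (hf m)
    exact Ideal.pow_le_pow_right (by omega) h
  eventually_top := ⟨0, fun n hn => by
    rw [eq_top_iff]
    intro f _ m
    simp [Int.toNat_of_nonpos hn]⟩

theorem mem_dual {n : ℤ} {f : Module.Dual A M} :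
    f ∈ (dual 𝔞 M).N n ↔ ∀ m : M, f m ∈ 𝔞 ^ n.toNat := Iff.rfl

/-- If `f(M) ⊆ 𝔞^n` then `f(𝔞^j M) ⊆ 𝔞^(n+j)`. -/
theorem dual_apply_mem {n j : ℤ} {f : Module.Dual A M} (hf : f ∈ (dual 𝔞 M).N n)
    {m : M} (hm : m ∈ (adic 𝔞 M).N j) : f m ∈ (adic 𝔞 A).N (n + j) := by
  rw [mem_adic_self]
  refine Submodule.smul_induction_on (p := fun x => f x ∈ 𝔞 ^ (n + j).toNat) hm ?_ ?_
  · intro a ha x _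
    rw [map_smul, smul_eq_mul]
    have h : a * f x ∈ 𝔞 ^ (j.toNat + n.toNat) := by
      rw [pow_add]
      exact Ideal.mul_mem_mul ha (hf x)
    exact Ideal.pow_le_pow_right (by omega) h
  · intro x y hx hy
    rw [map_add]
    exact Ideal.add_mem _ hx hy

/-- The graded piece `M_n / M_{n+1}` of the associated graded module. -/
def piece (F : IdealFiltration 𝔞 M) (n : ℤ) : Type v :=
  F.N n ⧸ (F.N (n + 1)).submoduleOf (F.N n)

instance (F : IdealFiltration 𝔞 M) (n : ℤ) : AddCommGroup (F.piece n) :=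
  inferInstanceAs (AddCommGroup (F.N n ⧸ (F.N (n + 1)).submoduleOf (F.N n)))

instance (F : IdealFiltration 𝔞 M) (n : ℤ) : Module A (F.piece n) :=
  inferInstanceAs (Module A (F.N n ⧸ (F.N (n + 1)).submoduleOf (F.N n)))

/-- The class in `M_n / M_{n+1}` of an element `x` of `M_n`. -/
def cls (F : IdealFiltration 𝔞 M) (n : ℤ) (x : M) (hx : x ∈ F.N n) : F.piece n :=
  Submodule.Quotient.mk (p := (F.N (n + 1)).submoduleOf (F.N n)) ⟨x, hx⟩

theorem cls_surjective (F : IdealFiltration 𝔞 M) {n : ℤ} (y : F.piece n) :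
    ∃ x hx, F.cls n x hx = y := by
  obtain ⟨x, rfl⟩ := Submodule.Quotient.mk_surjective _ y
  exact ⟨x.1, x.2, rfl⟩

theorem cls_eq_zero_iff (F : IdealFiltration 𝔞 M) {n : ℤ} {x : M} {hx : x ∈ F.N n} :
    F.cls n x hx = 0 ↔ x ∈ F.N (n + 1) :=
  Submodule.Quotient.mk_eq_zero _

theorem mk_cls_congr (F : IdealFiltration 𝔞 M) {i j : ℤ} {x y : M} (hij : i = j) (hxy : x = y)
    (hx : x ∈ F.N i) (hy : y ∈ F.N j) :
    GradedMonoid.mk (A := fun n => F.piece n) i (F.cls i x hx) =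
      GradedMonoid.mk j (F.cls j y hy) := by
  subst hij
  subst hxy
  rfl

theorem smul_mem_add (F : IdealFiltration 𝔞 M) {i j : ℤ} {a : A} {x : M}
    (ha : a ∈ (adic 𝔞 A).N i) (hx : x ∈ F.N j) : a • x ∈ F.N (i + j) :=
  F.pow_smul_le i j (Submodule.smul_mem_smul (mem_adic_self.1 ha) hx)

/-- The multiplication `𝔞^i / 𝔞^(i+1) × M_j / M_{j+1} → M_{i+j} / M_{i+j+1}`,
`(a + 𝔞^(i+1), x + M_{j+1}) ↦ a x + M_{i+j+1}`. -/
def smulPiece (F : IdealFiltration 𝔞 M) (i j : ℤ) :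
    (adic 𝔞 A).piece i →ₗ[A] F.piece j →ₗ[A] F.piece (i + j) :=
  Submodule.liftQ ((((adic 𝔞 A).N (i + 1))).submoduleOf ((adic 𝔞 A).N i))
    (LinearMap.flip
      (Submodule.liftQ ((F.N (j + 1)).submoduleOf (F.N j))
        (LinearMap.mk₂ A
          (fun (x : F.N j) (a : (adic 𝔞 A).N i) =>
            F.cls (i + j) ((a : A) • (x : M)) (F.smul_mem_add a.2 x.2))
          (fun x y a => congrArg (Submodule.Quotient.mk
            (p := (F.N (i + j + 1)).submoduleOf (F.N (i + j)))) (Subtype.ext (smul_add _ _ _)))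
          (fun c x a => congrArg (Submodule.Quotient.mk
            (p := (F.N (i + j + 1)).submoduleOf (F.N (i + j))))
              (Subtype.ext (smul_comm _ _ _)))
          (fun x a b => congrArg (Submodule.Quotient.mk
            (p := (F.N (i + j + 1)).submoduleOf (F.N (i + j)))) (Subtype.ext (add_smul _ _ _)))
          (fun c x a => congrArg (Submodule.Quotient.mk
            (p := (F.N (i + j + 1)).submoduleOf (F.N (i + j))))
              (Subtype.ext (smul_assoc _ _ _))))
        (fun x hx => by
          rw [LinearMap.mem_ker]
          ext a
          refine (F.cls_eq_zero_iff).2 ?_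
          rw [add_assoc]
          exact F.smul_mem_add a.2 hx)))
    (fun a ha => by
      rw [LinearMap.mem_ker]
      refine LinearMap.ext fun y => ?_
      obtain ⟨x, hx, rfl⟩ := F.cls_surjective y
      refine (F.cls_eq_zero_iff).2 ?_
      rw [show i + j + 1 = (i + 1) + j by ring]
      exact F.smul_mem_add ha hx)

theorem smulPiece_cls (F : IdealFiltration 𝔞 M) {i j : ℤ} {a : A} {x : M}
    (ha : a ∈ (adic 𝔞 A).N i) (hx : x ∈ F.N j) :
    F.smulPiece i j ((adic 𝔞 A).cls i a ha) (F.cls j x hx) =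
      F.cls (i + j) (a • x) (F.smul_mem_add ha hx) := rfl

end basic

section graded

variable {A : Type u} [CommRing A] (𝔞 : Ideal A)

theorem one_mem_adic : (1 : A) ∈ (adic 𝔞 A).N 0 := by
  simp [mem_adic_self]

theorem int_mem_adic (a : A) : a ∈ (adic 𝔞 A).N 0 := by
  simp [mem_adic_self]

instance : GradedMonoid.GMul (fun n : ℤ => (adic 𝔞 A).piece n) where
  mul {i j} a b := (adic 𝔞 A).smulPiece i j a b

instance : GradedMonoid.GOne (fun n : ℤ => (adic 𝔞 A).piece n) where
  one := (adic 𝔞 A).cls 0 1 (one_mem_adic 𝔞)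

/-- The graded ring structure of `(𝔞^n / 𝔞^(n+1))_{n ∈ ℤ}`, with the multiplication
induced by that of `A`. -/
instance : DirectSum.GCommRing (fun n : ℤ => (adic 𝔞 A).piece n) where
  mul_zero a := map_zero _
  zero_mul b := LinearMap.map_zero₂ _ b
  mul_add a b c := map_add _ _ _
  add_mul a b c := LinearMap.map_add₂ _ a b c
  one_mul := by
    rintro ⟨i, a⟩
    obtain ⟨x, hx, rfl⟩ := (adic 𝔞 A).cls_surjective a
    exact mk_cls_congr _ (zero_add i) (one_mul x) _ _
  mul_one := by
    rintro ⟨i, a⟩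
    obtain ⟨x, hx, rfl⟩ := (adic 𝔞 A).cls_surjective a
    exact mk_cls_congr _ (add_zero i) (mul_one x) _ _
  mul_assoc := by
    rintro ⟨i, a⟩ ⟨j, b⟩ ⟨k, c⟩
    obtain ⟨x, hx, rfl⟩ := (adic 𝔞 A).cls_surjective a
    obtain ⟨y, hy, rfl⟩ := (adic 𝔞 A).cls_surjective b
    obtain ⟨z, hz, rfl⟩ := (adic 𝔞 A).cls_surjective c
    exact mk_cls_congr _ (add_assoc i j k) (mul_assoc x y z) _ _
  mul_comm := by
    rintro ⟨i, a⟩ ⟨j, b⟩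
    obtain ⟨x, hx, rfl⟩ := (adic 𝔞 A).cls_surjective a
    obtain ⟨y, hy, rfl⟩ := (adic 𝔞 A).cls_surjective b
    exact mk_cls_congr _ (add_comm i j) (mul_comm x y) _ _
  natCast n := (adic 𝔞 A).cls 0 n (int_mem_adic 𝔞 _)
  natCast_zero := by
    rw [cls_eq_zero_iff]
    simp
  natCast_succ n := congrArg (Submodule.Quotient.mk
    (p := ((adic 𝔞 A).N (0 + 1)).submoduleOf ((adic 𝔞 A).N 0)))
      (Subtype.ext (Nat.cast_succ n))
  intCast n := (adic 𝔞 A).cls 0 n (int_mem_adic 𝔞 _)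
  intCast_ofNat n := congrArg (Submodule.Quotient.mk
    (p := ((adic 𝔞 A).N (0 + 1)).submoduleOf ((adic 𝔞 A).N 0)))
      (Subtype.ext (Int.cast_natCast n))
  intCast_negSucc_ofNat n := congrArg (Submodule.Quotient.mk
    (p := ((adic 𝔞 A).N (0 + 1)).submoduleOf ((adic 𝔞 A).N 0)))
      (Subtype.ext (Int.cast_negSucc n))

variable {𝔞} {M : Type v} [AddCommGroup M] [Module A M]

/-- The graded module structure of `(M_n / M_{n+1})_{n ∈ ℤ}` over `(𝔞^n / 𝔞^(n+1))_{n ∈ ℤ}`. -/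
instance (F : IdealFiltration 𝔞 M) :
    DirectSum.Gmodule (fun n : ℤ => (adic 𝔞 A).piece n) (fun n : ℤ => F.piece n) where
  smul {i j} a b := F.smulPiece i j a b
  one_smul := by
    rintro ⟨i, a⟩
    obtain ⟨x, hx, rfl⟩ := F.cls_surjective a
    exact mk_cls_congr _ (zero_add i) (one_smul A x) _ _
  mul_smul := by
    rintro ⟨i, a⟩ ⟨j, b⟩ ⟨k, c⟩
    obtain ⟨x, hx, rfl⟩ := (adic 𝔞 A).cls_surjective a
    obtain ⟨y, hy, rfl⟩ := (adic 𝔞 A).cls_surjective b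
    obtain ⟨z, hz, rfl⟩ := F.cls_surjective c
    exact mk_cls_congr _ (add_assoc i j k) (mul_smul x y z) _ _
  smul_add a b c := map_add _ _ _
  smul_zero a := map_zero _
  add_smul a b c := LinearMap.map_add₂ _ a b c
  zero_smul b := LinearMap.map_zero₂ _ b

/-- The associated graded module `G(F, M) = ⨁_{n ∈ ℤ} M_n / M_{n+1}`. -/
abbrev gr (F : IdealFiltration 𝔞 M) : Type v := ⨁ n : ℤ, F.piece n

variable (𝔞) in
/-- The associated graded ring `G_𝔞(A) = ⨁_n 𝔞^n / 𝔞^(n+1)`. It is indexed by `ℤ`, the components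
of negative degree being zero. -/
abbrev grRing : Type u := gr (adic 𝔞 A)

variable (𝔞 M) in
/-- The associated graded module `G_𝔞(M) = ⨁_n 𝔞^n M / 𝔞^(n+1) M`. It is indexed by `ℤ`, the
components of negative degree being zero. -/
abbrev grModule : Type v := gr (adic 𝔞 M)

theorem subsingleton_piece_adic {n : ℤ} (hn : n < 0) : Subsingleton ((adic 𝔞 M).piece n) := by
  refine subsingleton_of_forall_eq 0 fun y => ?_
  obtain ⟨x, hx, rfl⟩ := (adic 𝔞 M).cls_surjective y
  rw [cls_eq_zero_iff]
  have h : (n + 1).toNat = 0 := Int.toNat_of_nonpos (by omega)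
  simp [adic, h]

end graded

end IdealFiltration

section StarHom

variable (R : ℤ → Type u) [∀ n, AddCommGroup (R n)] [DirectSum.GCommRing R]
  (X : ℤ → Type v) [∀ n, AddCommGroup (X n)] [DirectSum.Gmodule R X]
  (Y : ℤ → Type w) [∀ n, AddCommGroup (Y n)] [DirectSum.Gmodule R Y]

/-- The group `*Hom_R(X, Y)_n` of `R`-linear maps `φ : X → Y` that are homogeneous of degree `n`,
that is, `φ(X_j) ⊆ Y_{n+j}` for all `j`. -/
def starHomDegree (n : ℤ) : AddSubgroup ((⨁ j, X j) →ₗ[⨁ j, R j] (⨁ j, Y j)) where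
  carrier := {φ | ∀ (j : ℤ) (x : X j),
    φ (DirectSum.of X j x) ∈ (DirectSum.of Y (n + j)).range}
  add_mem' hφ hψ j x := AddSubgroup.add_mem _ (hφ j x) (hψ j x)
  zero_mem' _ _ := AddSubgroup.zero_mem _
  neg_mem' hφ j x := AddSubgroup.neg_mem _ (hφ j x)

theorem starHomDegree_of_smul {i n : ℤ} (r : R i)
    {φ : (⨁ j, X j) →ₗ[⨁ j, R j] (⨁ j, Y j)} (hφ : φ ∈ starHomDegree R X Y n) :
    DirectSum.of R i r • φ ∈ starHomDegree R X Y (i + n) := by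
  intro j x
  obtain ⟨y, hy⟩ := hφ j x
  refine ⟨cast (congrArg Y (add_assoc i n j).symm) (GradedMonoid.GSMul.smul r y), ?_⟩
  have h : (DirectSum.of R i r • φ) (DirectSum.of X j x) =
      DirectSum.of Y (i + (n + j)) (GradedMonoid.GSMul.smul r y) := by
    rw [LinearMap.smul_apply, ← hy, DirectSum.Gmodule.of_smul_of]
    rfl
  rw [h]
  exact DirectSum.of_eq_of_gradedMonoid_eq
    (Sigma.ext (add_assoc i n j) (cast_heq _ _))

/-- `*Hom_R(X, Y) = ⨁_n *Hom_R(X, Y)_n`, the `R`-submodule of `Hom_R(X, Y)` consisting of the finite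
sums of homogeneous maps. -/
def starHom : Submodule (⨁ j, R j) ((⨁ j, X j) →ₗ[⨁ j, R j] (⨁ j, Y j)) where
  __ := (⨆ n : ℤ, starHomDegree R X Y n)
  smul_mem' r φ hφ := by
    change r • φ ∈ ⨆ n : ℤ, starHomDegree R X Y n
    have hφ' : φ ∈ ⨆ n : ℤ, starHomDegree R X Y n := hφ
    induction r using DirectSum.induction_on with
    | zero => rw [zero_smul]; exact AddSubgroup.zero_mem _
    | add r s hr hs => rw [add_smul]; exact AddSubgroup.add_mem _ hr hs
    | of i r =>
      induction hφ' using AddSubgroup.iSup_induction' with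
      | hp n ψ hψ => exact AddSubgroup.mem_iSup_of_mem (i + n) (starHomDegree_of_smul R X Y r hψ)
      | h1 => rw [smul_zero]; exact AddSubgroup.zero_mem _
      | hadd ψ χ hψ hχ h₁ h₂ =>
        rw [smul_add]
        exact AddSubgroup.add_mem _ (h₁ hψ) (h₂ hχ)

end StarHom

section CohenMacaulayGorenstein

open CategoryTheory

/-- The depth of a module over a local ring: the supremum of the lengths of the `M`-regular
sequences in the maximal ideal. -/
noncomputable def localDepth (R : Type u) [CommRing R] [IsLocalRing R]
    (M : Type v) [AddCommGroup M] [Module R M] : ℕ∞ :=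
  ⨆ (rs : List R) (_ : (∀ r ∈ rs, r ∈ IsLocalRing.maximalIdeal R) ∧
    RingTheory.Sequence.IsRegular M rs), (rs.length : ℕ∞)

/-- A finite module over a (Noetherian) local ring is Cohen-Macaulay if it is zero or its depth
equals its dimension. -/
structure IsCohenMacaulayLocal (R : Type u) [CommRing R] [IsLocalRing R]
    (M : Type v) [AddCommGroup M] [Module R M] : Prop where
  finite : Module.Finite R M
  depth_eq : Subsingleton M ∨ ((localDepth R M : ℕ∞) : WithBot ℕ∞) = Module.supportDim R M

/-- A maximal Cohen-Macaulay module over a (Noetherian) local ring: a Cohen-Macaulay module whose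
dimension is that of the ring. -/
structure IsMaximalCohenMacaulayLocal (R : Type u) [CommRing R] [IsLocalRing R]
    (M : Type v) [AddCommGroup M] [Module R M] : Prop where
  isCohenMacaulay : IsCohenMacaulayLocal R M
  dim_eq : Module.supportDim R M = ringKrullDim R

/-- A finite module over a (Noetherian) ring is Cohen-Macaulay if all its localizations at maximal
ideals are. -/
structure IsCohenMacaulayModule (R : Type u) [CommRing R]
    (M : Type v) [AddCommGroup M] [Module R M] : Prop where
  finite : Module.Finite R M
  localization : ∀ (p : Ideal R) [p.IsMaximal],
    IsCohenMacaulayLocal (Localization.AtPrime p) (LocalizedModule p.primeCompl M)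

/-- A Noetherian local ring is Gorenstein if it has finite injective dimension as a module over
itself. -/
structure IsGorensteinLocalRing (R : Type u) [CommRing R] [IsLocalRing R] : Prop where
  noetherian : IsNoetherianRing R
  finite_injectiveDimension : ∃ n : ℕ, HasInjectiveDimensionLE (ModuleCat.of R R) n

/-- A Noetherian ring is Gorenstein if all its localizations at maximal ideals are. -/
structure IsGorensteinRing (R : Type u) [CommRing R] : Prop where
  noetherian : IsNoetherianRing R
  localization : ∀ (p : Ideal R) [p.IsMaximal], IsGorensteinLocalRing (Localization.AtPrime p)

end CohenMacaulayGorenstein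

open IdealFiltration

/-!
The natural map `Φ_M : G(F, M^*) → *Hom(G(M), G(A))`, with `G = G_𝔞`, is `dualMap`. It is injective
for every module `M` (`dualMap_injective`), so the content is that every homogeneous map
`φ : G(M) → G(A)` of degree `n` is `gr(f)` for some `f : M → A` with `f(M) ⊆ 𝔞^n`
(`exists_grMap_eq_of_mem_starHomDegree`).

Choose generators `x i` of `M` and let `N ⊆ A^ι` be their module of relations, with the filtration
induced by the `𝔞`-adic one. Then `0 → gr(N) → G(A)^ι → G(M) → 0` is exact
(`coordMap_injective`, `exact_coordMap_genMap`, `genMap_surjective`). Lifting the values of `φ` on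
the generators gives a functional `g` on `A^ι` with `g(N_j) ⊆ 𝔞^{n+1+j}`. Its restriction to `N`
induces a map `gr(N) → G(A)` of degree `n + 1`; when this map extends to `G(A)^ι`, its extension
lifts to a functional with coefficients in `𝔞^{n+1}`, and subtracting that from `g` gives
`g(N_j) ⊆ 𝔞^{n+2+j}` (`exists_correction`). Iterating, the values of `g` at finitely many
generators of `N` lie in the submodule obtained from functionals with coefficients in `𝔞^{n+1}` up
to arbitrarily high powers of `𝔞`, hence in that submodule, by Krull's intersection theorem
(`exists_functional`). So `g` may be corrected to vanish on `N`, and it descends to `M`.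

The extension property is the vanishing of `Ext^1(G(M), G(A))`. It is needed only at the graded
maximal ideal, because an element outside that ideal has a unit of `A` as its component of degree
zero (`exists_isUnit_of_grResidue_ne_zero`). Let `S` be the localization of `G(A)` there and `X` that
of `G(M)`. Since `S` is Gorenstein, `Ext^i(-, S)` vanishes on finite modules for `i` larger than the
length `r` of a suitable `S`-regular sequence
(`IsGorensteinLocalRing.exists_isRegular_subsingleton_ext`), and each element of an `X`-regular
sequence lowers this bound for `X` by one (`subsingleton_ext_of_isRegular`). It remains to see that
`depth X ≥ r`. As `X` is Cohen-Macaulay, `dim X ≥ r` suffices, and this holds as soon as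
`Hom(X, S) ≠ 0`: then the support of `X` contains an associated prime `p` of `S`, and
`r ≤ dim S/p` (`length_le_supportDim_of_exists_linearMap_ne_zero`). Finally `Hom(X, S) ≠ 0`
because `M^* ≠ 0`, the dimension of `M` being that of `A` (`exists_dual_ne_zero_of_supportDim_eq`),
and a nonzero `f` in `M^*` gives a nonzero `gr(f)`. In this way the dimensions of `G(M)` and `G(A)`
never have to be computed.
-/

/-! ### Vanishing of `Ext` over local rings -/

theorem Ideal.IsPrime.isSMulRegular_quotient_of_notMem {R : Type u} [CommRing R] {p : Ideal R}
    (hp : p.IsPrime) {x : R} (hx : x ∉ p) : IsSMulRegular (R ⧸ p) x :=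
  (isSMulRegular_quotient_iff_mem_of_smul_mem p x).2 fun _ hy => (hp.mem_or_mem hy).resolve_left hx

section ExtVanishing

open CategoryTheory Abelian IsLocalRing RingTheory.Sequence Pointwise

variable {R : Type u} [CommRing R]

theorem subsingleton_ext_left_of_shortExact {S : ShortComplex (ModuleCat.{u} R)}
    (hS : S.ShortExact) (Y : ModuleCat.{u} R) (i : ℕ) (h₂ : Subsingleton (Ext S.X₂ Y i))
    (h₃ : Subsingleton (Ext S.X₃ Y (i + 1))) : Subsingleton (Ext S.X₁ Y i) := by
  refine subsingleton_of_forall_eq 0 fun e => ?_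
  obtain ⟨x, rfl⟩ := Ext.contravariant_sequence_exact₁ hS Y e (add_comm 1 i)
    (Subsingleton.elim _ _)
  rw [Subsingleton.elim x 0, Ext.comp_zero]

theorem subsingleton_ext_middle_of_shortExact {S : ShortComplex (ModuleCat.{u} R)}
    (hS : S.ShortExact) (Y : ModuleCat.{u} R) (i : ℕ) (h₁ : Subsingleton (Ext S.X₁ Y i))
    (h₃ : Subsingleton (Ext S.X₃ Y i)) : Subsingleton (Ext S.X₂ Y i) := by
  refine subsingleton_of_forall_eq 0 fun e => ?_
  obtain ⟨x, rfl⟩ := Ext.contravariant_sequence_exact₂ hS Y e (Subsingleton.elim _ _)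
  rw [Subsingleton.elim x 0, Ext.comp_zero]

theorem subsingleton_ext_right_of_shortExact {S : ShortComplex (ModuleCat.{u} R)}
    (hS : S.ShortExact) (Y : ModuleCat.{u} R) (i : ℕ) (h₁ : Subsingleton (Ext S.X₁ Y i))
    (h₂ : Subsingleton (Ext S.X₂ Y (i + 1))) : Subsingleton (Ext S.X₃ Y (i + 1)) := by
  refine subsingleton_of_forall_eq 0 fun e => ?_
  obtain ⟨x, rfl⟩ := Ext.contravariant_sequence_exact₃ hS Y e (Subsingleton.elim _ _)
    (add_comm 1 i)
  rw [Subsingleton.elim x 0, Ext.comp_zero]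

theorem subsingleton_ext_of_linearEquiv {N N' : Type u} [AddCommGroup N] [Module R N]
    [AddCommGroup N'] [Module R N'] (e : N ≃ₗ[R] N') (Y : ModuleCat.{u} R) (i : ℕ)
    (h : Subsingleton (Ext (ModuleCat.of R N') Y i)) :
    Subsingleton (Ext (ModuleCat.of R N) Y i) := by
  refine subsingleton_of_forall_eq 0 fun x => ?_
  have hx : x = (Ext.mk₀ e.toModuleIso.hom).comp
      ((Ext.mk₀ e.toModuleIso.inv).comp x (zero_add i)) (zero_add i) := by
    rw [Ext.mk₀_comp_mk₀_assoc, Iso.hom_inv_id, Ext.mk₀_id_comp]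
  rw [hx, Subsingleton.elim ((Ext.mk₀ e.toModuleIso.inv).comp x (zero_add i)) 0, Ext.comp_zero]

/-- If `x` is `N`-regular and `Ext^{i+1}(N/xN, Y) = 0`, then multiplication by `x` is surjective on
the finite module `Ext^i(N, Y)`, which therefore vanishes by Nakayama's lemma. -/
theorem subsingleton_ext_of_quotSMulTop [IsNoetherianRing R] [IsLocalRing R]
    {N : Type u} [AddCommGroup N] [Module R N] [Module.Finite R N] (Y : ModuleCat.{u} R)
    [Module.Finite R Y] {x : R} (hx : x ∈ maximalIdeal R) (hreg : IsSMulRegular N x) (i : ℕ)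
    (h : Subsingleton (Ext (ModuleCat.of R (QuotSMulTop x N)) Y (i + 1))) :
    Subsingleton (Ext (ModuleCat.of R N) Y i) := by
  have hS := IsSMulRegular.smulShortComplex_shortExact (M := ModuleCat.of R N) hreg
  have htop : (⊤ : Submodule R (Ext (ModuleCat.of R N) Y i)) ≤
      maximalIdeal R • (⊤ : Submodule R (Ext (ModuleCat.of R N) Y i)) := by
    intro e _
    have : Subsingleton (Ext ((ModuleCat.of R N).smulShortComplex x).X₃ Y (i + 1)) := h
    obtain ⟨y, rfl⟩ := Ext.contravariant_sequence_exact₁ hS Y e (add_comm 1 i)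
      (Subsingleton.elim _ _)
    have hy (y : Ext (ModuleCat.of R N) Y i) :
        (Ext.mk₀ (x • 𝟙 (ModuleCat.of R N))).comp y (zero_add i) = x • y := by
      rw [Ext.mk₀_smul, Ext.smul_comp, Ext.mk₀_id_comp]
    exact Set.mem_of_eq_of_mem (hy y) (Submodule.smul_mem_smul hx trivial)
  have hbot := Submodule.eq_bot_of_le_smul_of_le_jacobson_bot (maximalIdeal R) _
    (Module.Finite.fg_top) htop (maximalIdeal_le_jacobson _)
  exact (Submodule.subsingleton_iff R).1 (subsingleton_of_bot_eq_top hbot.symm)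

/-- If `rs` is `N`-regular and `Ext^j(N, Y) = 0` for `j > s`, then `Ext^j(N/(rs)N, Y) = 0` for
`j > s + length rs`. -/
theorem subsingleton_ext_quotient_of_isWeaklyRegular (Y : ModuleCat.{u} R) (rs : List R)
    {N : Type u} [AddCommGroup N] [Module R N] (hrs : IsWeaklyRegular N rs) (s : ℕ)
    (h : ∀ j > s, Subsingleton (Ext (ModuleCat.of R N) Y j)) :
    ∀ j > s + rs.length,
      Subsingleton (Ext (ModuleCat.of R (N ⧸ Ideal.ofList rs • (⊤ : Submodule R N))) Y j) := by
  induction rs generalizing N s with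
  | nil =>
    intro j hj
    refine subsingleton_ext_of_linearEquiv (Submodule.quotEquivOfEqBot _ ?_) Y j (h j hj)
    rw [Ideal.ofList_nil, Submodule.bot_smul]
  | cons x xs ih =>
    intro j hj
    rw [isWeaklyRegular_cons_iff] at hrs
    rw [List.length_cons] at hj
    refine subsingleton_ext_of_linearEquiv
      (Submodule.quotOfListConsSMulTopEquivQuotSMulTopInner N x xs) Y j
      (ih hrs.2 (s + 1) (fun k hk => ?_) j (by omega))
    obtain ⟨k, rfl⟩ : ∃ l, k = l + 1 := ⟨k - 1, by omega⟩
    have hS := IsSMulRegular.smulShortComplex_shortExact (M := ModuleCat.of R N) hrs.1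
    exact subsingleton_ext_right_of_shortExact hS Y k (h k (by omega)) (h (k + 1) (by omega))

/-- If `Ext^j(-, Y)` vanishes on finite modules for `j > n + 1` and `Ext^{n+1}(k, Y) = 0` for the
residue field `k`, then `Ext^{n+1}(-, Y)` vanishes on finite modules. -/
theorem subsingleton_ext_succ_of_residueField [IsNoetherianRing R] [IsLocalRing R]
    (Y : ModuleCat.{u} R) [Module.Finite R Y] (n : ℕ)
    (h : ∀ (N : Type u) [AddCommGroup N] [Module R N] [Module.Finite R N],
      Subsingleton (Ext (ModuleCat.of R N) Y (n + 2)))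
    (hk : Subsingleton (Ext (ModuleCat.of R (R ⧸ maximalIdeal R)) Y (n + 1)))
    (N : Type u) [AddCommGroup N] [Module R N] [hN : Module.Finite R N] :
    Subsingleton (Ext (ModuleCat.of R N) Y (n + 1)) := by
  induction hN using IsNoetherianRing.induction_on_isQuotientEquivQuotientPrime R with
  | subsingleton N =>
    refine subsingleton_of_forall_eq 0 fun e => ?_
    have hid : 𝟙 (ModuleCat.of R N) = 0 := by ext x; exact Subsingleton.elim _ _
    rw [← Ext.mk₀_id_comp e, hid, Ext.mk₀_zero, Ext.zero_comp]
  | quotient N p e =>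
    refine subsingleton_ext_of_linearEquiv e Y _ ?_
    by_cases hp : p.asIdeal = maximalIdeal R
    · rw [hp]; exact hk
    · -- some `x` in the maximal ideal is regular on `R ⧸ p`
      obtain ⟨x, hx, hxp⟩ : ∃ x ∈ maximalIdeal R, x ∉ p.asIdeal := by
        by_contra! hcon
        exact hp (le_antisymm (le_maximalIdeal p.2.ne_top) hcon)
      exact subsingleton_ext_of_quotSMulTop Y hx (p.2.isSMulRegular_quotient_of_notMem hxp) _ (h _)
  | exact N₁ N₂ N₃ f g hf hg hfg h₁ h₃ =>
    let S : ShortComplex (ModuleCat.{u} R) :=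
      ModuleCat.shortComplexOfCompEqZero f g hfg.linearMap_comp_eq_zero
    exact subsingleton_ext_middle_of_shortExact
      (ModuleCat.shortComplex_shortExact S hfg hf hg) Y (n + 1) h₁ h₃

end ExtVanishing

/-! ### Gorenstein local rings and Cohen-Macaulay modules -/

section Gorenstein

open CategoryTheory Abelian IsLocalRing RingTheory.Sequence Pointwise

variable {R : Type u} [CommRing R] [IsLocalRing R]

theorem exists_ringKrullDim_eq_natCast (R : Type u) [CommRing R] [IsLocalRing R]
    [IsNoetherianRing R] : ∃ d : ℕ, ringKrullDim R = d := by
  have h1 := ringKrullDim_ne_bot (R := R)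
  have h2 := (ringKrullDim_lt_top (R := R)).ne
  generalize ringKrullDim R = x at h1 h2
  induction x with
  | bot => exact absurd rfl h1
  | coe x =>
    induction x with
    | top => exact absurd rfl h2
    | coe d => exact ⟨d, rfl⟩

/-- A regular sequence of maximal length: no further element of the maximal ideal is regular modulo
it, so that the residue field embeds in the quotient. -/
theorem exists_isRegular_residueField_injective [IsNoetherianRing R] :
    ∃ rs : List R, IsRegular R rs ∧ (∀ r ∈ rs, r ∈ maximalIdeal R) ∧
      ∃ f : (R ⧸ maximalIdeal R) →ₗ[R] (R ⧸ Ideal.ofList rs • (⊤ : Submodule R R)),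
        Function.Injective f := by
  by_contra! hcon
  -- otherwise every regular sequence extends, contradicting the bound `length ≤ dim R`
  have key : ∀ n : ℕ, ∃ rs : List R, rs.length = n ∧ IsRegular R rs ∧
      ∀ r ∈ rs, r ∈ maximalIdeal R := by
    intro n
    induction n with
    | zero => exact ⟨[], rfl, IsRegular.nil R R, by simp⟩
    | succ n ih =>
      obtain ⟨rs, rfl, hrs, hmem⟩ := ih
      have hsub : Subsingleton
          ((R ⧸ maximalIdeal R) →ₗ[R] (R ⧸ Ideal.ofList rs • (⊤ : Submodule R R))) := by
        refine subsingleton_of_forall_eq 0 fun f => ?_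
        have : IsSimpleModule R (R ⧸ maximalIdeal R) :=
          isSimpleModule_iff_isCoatom.2 (Ideal.isMaximal_def.1 inferInstance)
        exact (LinearMap.injective_or_eq_zero f).resolve_left (hcon rs hrs hmem f)
      obtain ⟨x, hx, hreg⟩ := IsSMulRegular.subsingleton_linearMap_iff.1 hsub
      rw [Ideal.annihilator_quotient] at hx
      have hmem' : ∀ r ∈ rs ++ [x], r ∈ maximalIdeal R := by
        intro r hr
        rcases List.mem_append.1 hr with hr | hr
        · exact hmem r hr
        · rwa [List.mem_singleton.1 hr]
      refine ⟨rs ++ [x], by simp, ?_, hmem'⟩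
      exact IsRegular.of_isWeaklyRegular_of_mem_maximalIdeal R hmem'
        ((isWeaklyRegular_append_iff R rs [x]).2
          ⟨hrs.toIsWeaklyRegular, (isWeaklyRegular_singleton_iff _ x).2 hreg⟩)
  obtain ⟨d, hd⟩ := exists_ringKrullDim_eq_natCast R
  obtain ⟨rs, hlen, hrs, hmem⟩ := key (d + 1)
  have hadd := ringKrullDim_add_length_eq_ringKrullDim_of_isRegular rs hrs
  have hnt : Nontrivial (R ⧸ Ideal.ofList rs) := Ideal.Quotient.nontrivial_iff.2 fun htop =>
    hrs.2 (by rw [htop, Submodule.top_smul])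
  have hle : ((d + 1 : ℕ) : WithBot ℕ∞) ≤ d := by
    rw [← hd, ← hadd, hlen]
    exact le_add_of_nonneg_left ringKrullDim_nonneg_of_nontrivial
  exact absurd hle (by norm_cast; omega)

/-- Over a Gorenstein local ring there is a regular sequence in the maximal ideal beyond whose length
`Ext^i(-, R)` vanishes on finite modules. -/
theorem IsGorensteinLocalRing.exists_isRegular_subsingleton_ext (hR : IsGorensteinLocalRing R) :
    ∃ rs : List R, IsRegular R rs ∧ (∀ r ∈ rs, r ∈ maximalIdeal R) ∧
      ∀ (N : Type u) [AddCommGroup N] [Module R N] [Module.Finite R N], ∀ i > rs.length,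
        Subsingleton (Ext (ModuleCat.of R N) (ModuleCat.of R R) i) := by
  have := hR.noetherian
  obtain ⟨rs, hrs, hmem, f, hf⟩ := exists_isRegular_residueField_injective (R := R)
  refine ⟨rs, hrs, hmem, ?_⟩
  obtain ⟨n₀, hn₀⟩ := hR.finite_injectiveDimension
  -- descending induction: if vanishing holds beyond `rs.length + m`, it holds beyond `rs.length`
  have key : ∀ m : ℕ, (∀ (N : Type u) [AddCommGroup N] [Module R N] [Module.Finite R N],
      ∀ i > rs.length + m, Subsingleton (Ext (ModuleCat.of R N) (ModuleCat.of R R) i)) →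
      ∀ (N : Type u) [AddCommGroup N] [Module R N] [Module.Finite R N], ∀ i > rs.length,
        Subsingleton (Ext (ModuleCat.of R N) (ModuleCat.of R R) i) := by
    intro m
    induction m with
    | zero => exact id
    | succ m ih =>
      intro h
      refine ih fun N _ _ _ i hi => ?_
      obtain hi' | rfl := Nat.lt_or_eq_of_le (Nat.succ_le_of_lt hi)
      · exact h N i (by omega)
      refine subsingleton_ext_succ_of_residueField _ _ (fun N _ _ _ => h N _ (by omega)) ?_ N
      -- `Ext^{i}(R/(rs), R) = 0` since `R/(rs)` has projective dimension at most `rs.length`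
      have hfree : ∀ j > 0, Subsingleton (Ext (ModuleCat.of R R) (ModuleCat.of R R) j) := by
        intro j hj
        obtain ⟨j, rfl⟩ : ∃ l, j = l + 1 := ⟨j - 1, by omega⟩
        exact Ext.subsingleton_of_projective _ _ _
      have hq := subsingleton_ext_quotient_of_isWeaklyRegular (ModuleCat.of R R) rs
        hrs.toIsWeaklyRegular 0 hfree (rs.length + m + 1) (by omega)
      let S : ShortComplex (ModuleCat.{u} R) :=
        ModuleCat.shortComplexOfCompEqZero f f.range.mkQ
          (f.exact_map_mkQ_range).linearMap_comp_eq_zero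
      exact subsingleton_ext_left_of_shortExact
        (ModuleCat.shortComplex_shortExact S f.exact_map_mkQ_range hf
          (Submodule.mkQ_surjective _)) _ _ hq (h _ _ (by omega))
  refine key n₀ fun N _ _ _ i hi => ?_
  exact HasInjectiveDimensionLT.subsingleton (ModuleCat.of R R) (n₀ + 1) i (by omega) _

/-- If `Ext^i(-, Y)` vanishes on finite modules for `i > r` and `rs` is `N`-regular, then
`Ext^i(N, Y) = 0` for `i > r - length rs`. -/
theorem subsingleton_ext_of_isRegular [IsNoetherianRing R] (Y : ModuleCat.{u} R)
    [Module.Finite R Y] (r : ℕ)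
    (h : ∀ (N : Type u) [AddCommGroup N] [Module R N] [Module.Finite R N], ∀ i > r,
      Subsingleton (Ext (ModuleCat.of R N) Y i)) (rs : List R) :
    ∀ (N : Type u) [AddCommGroup N] [Module R N] [Module.Finite R N], IsWeaklyRegular N rs →
      (∀ x ∈ rs, x ∈ maximalIdeal R) → ∀ i, i + rs.length > r →
      Subsingleton (Ext (ModuleCat.of R N) Y i) := by
  induction rs with
  | nil => intro N _ _ _ _ _ i hi; exact h N i hi
  | cons x xs ih =>
    intro N _ _ _ hreg hmem i hi
    rw [isWeaklyRegular_cons_iff] at hreg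
    rw [List.length_cons] at hi
    exact subsingleton_ext_of_quotSMulTop Y (hmem x List.mem_cons_self) hreg.1 i
      (ih _ hreg.2 (fun y hy => hmem y (List.mem_cons_of_mem _ hy)) (i + 1) (by omega))

/-- The length of an `M`-regular sequence is at most the dimension of `R ⧸ p` for each associated
prime `p` of `M`. -/
theorem length_le_supportDim_quotient_of_mem_associatedPrimes [IsNoetherianRing R] (rs : List R) :
    ∀ (M : Type v) [AddCommGroup M] [Module R M] [Module.Finite R M], IsWeaklyRegular M rs →
      (∀ x ∈ rs, x ∈ maximalIdeal R) → ∀ p ∈ associatedPrimes R M,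
      ((rs.length : ℕ∞) : WithBot ℕ∞) ≤ Module.supportDim R (R ⧸ p) := by
  induction rs with
  | nil =>
    intro M _ _ _ _ _ p hp
    have := hp.isPrime
    rw [Module.supportDim_quotient_eq_ringKrullDim]
    exact ringKrullDim_nonneg_of_nontrivial
  | cons x xs ih =>
    intro M _ _ _ hreg hmem p hp
    have hp' := hp.isPrime
    rw [isWeaklyRegular_cons_iff] at hreg
    have hx : x ∈ maximalIdeal R := hmem x List.mem_cons_self
    obtain ⟨-, m₀, hm₀⟩ := isAssociatedPrime_iff.1 hp
    have hm₀' : m₀ ≠ 0 := by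
      rintro rfl
      exact hp'.ne_top (by simp [hm₀])
    -- by Nakayama's lemma, some `z` killed by `p` does not lie in `x M`
    obtain ⟨z, hz, hzx⟩ : ∃ z : M, (∀ a ∈ p, a • z = 0) ∧ z ∉ x • (⊤ : Submodule R M) := by
      by_contra! hcon
      let N := Submodule.torsionBySet R M (p : Set R)
      have hN (z : M) : z ∈ N ↔ ∀ a ∈ p, a • z = 0 := by
        simp [N, Submodule.mem_torsionBySet_iff]
      have hle : N ≤ maximalIdeal R • N := by
        intro z hz
        obtain ⟨y, -, rfl⟩ := (Submodule.mem_smul_pointwise_iff_exists _ _ _).1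
          (hcon z ((hN z).1 hz))
        refine Submodule.smul_mem_smul hx ((hN y).2 fun a ha => ?_)
        refine hreg.1.right_eq_zero_of_smul ?_
        rw [smul_comm]
        exact (hN _).1 hz a ha
      have hbot := Submodule.eq_bot_of_le_smul_of_le_jacobson_bot (maximalIdeal R) N
        (IsNoetherian.noetherian N) hle (maximalIdeal_le_jacobson _)
      have hmem₀ : m₀ ∈ N := by
        refine (hN m₀).2 fun a ha => ?_
        rw [hm₀] at ha
        simpa [Submodule.mem_colon_singleton] using ha
      rw [hbot] at hmem₀
      exact hm₀' ((Submodule.mem_bot R).1 hmem₀)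
    have hz0 : (x • (⊤ : Submodule R M)).mkQ z ≠ 0 := by
      rwa [Submodule.mkQ_apply, Ne, Submodule.Quotient.mk_eq_zero]
    obtain ⟨q, hq, hle⟩ := exists_le_isAssociatedPrime_of_isNoetherianRing R
      (M := QuotSMulTop x M) _ hz0
    have hpq : p ≤ q := fun a ha => hle (Submodule.mem_colon_singleton.2 (by
      rw [← map_smul, hz a ha, map_zero]; exact Submodule.zero_mem _))
    have hxq : x ∈ q := hle (Submodule.mem_colon_singleton.2 (by
      rw [← map_smul, Submodule.mem_bot, Submodule.mkQ_apply, Submodule.Quotient.mk_eq_zero]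
      exact Submodule.smul_mem_pointwise_smul z x ⊤ trivial))
    have hxp : x ∉ p := by
      intro hxp
      rw [hm₀, Submodule.mem_colon_singleton] at hxp
      exact hm₀' (hreg.1.right_eq_zero_of_smul hxp)
    have hdim := Module.supportDim_quotSMulTop_succ_eq_supportDim
      (hp'.isSMulRegular_quotient_of_notMem hxp) hx
    have hih := ih (QuotSMulTop x M) hreg.2 (fun y hy => hmem y (List.mem_cons_of_mem _ hy)) q hq
    have hsurj : Module.supportDim R (R ⧸ q) ≤ Module.supportDim R (QuotSMulTop x (R ⧸ p)) := by
      have hker : x • (⊤ : Submodule R (R ⧸ p)) ≤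
          LinearMap.ker (Submodule.factor hpq) := by
        intro y hy
        obtain ⟨y, -, rfl⟩ := (Submodule.mem_smul_pointwise_iff_exists _ _ _).1 hy
        obtain ⟨y, rfl⟩ := Submodule.Quotient.mk_surjective _ y
        rw [LinearMap.mem_ker, map_smul, ← Submodule.mkQ_apply, Submodule.factor_mk,
          Submodule.mkQ_apply, ← Submodule.Quotient.mk_smul, Submodule.Quotient.mk_eq_zero]
        exact q.mul_mem_right y hxq
      refine Module.supportDim_le_of_surjective (Submodule.liftQ _ (Submodule.factor hpq) hker) ?_
      exact LinearMap.range_eq_top.1 ((Submodule.range_liftQ _ _ _).trans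
        (LinearMap.range_eq_top.2 (Submodule.factor_surjective hpq)))
    rw [← hdim, List.length_cons]
    push_cast
    gcongr
    exact hih.trans hsurj

/-- A nonzero map from a finite module `X` to a finite module `M` yields an associated prime of `M`
in the support of `X`, hence bounds the length of an `M`-regular sequence by `dim X`. -/
theorem length_le_supportDim_of_exists_linearMap_ne_zero [IsNoetherianRing R] {M : Type w}
    [AddCommGroup M] [Module R M] [Module.Finite R M] {X : Type v} [AddCommGroup X] [Module R X]
    {f : X →ₗ[R] M} (hf : f ≠ 0) {rs : List R} (hrs : IsWeaklyRegular M rs)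
    (hmem : ∀ x ∈ rs, x ∈ maximalIdeal R) :
    ((rs.length : ℕ∞) : WithBot ℕ∞) ≤ Module.supportDim R X := by
  obtain ⟨x, hx⟩ : ∃ x, f x ≠ 0 := by
    by_contra! hcon
    exact hf (LinearMap.ext hcon)
  obtain ⟨p, hp, hle⟩ := exists_le_isAssociatedPrime_of_isNoetherianRing R (f x) hx
  have hp' := hp.isPrime
  refine (length_le_supportDim_quotient_of_mem_associatedPrimes rs M hrs hmem p hp).trans ?_
  have hpX : (⟨p, hp'⟩ : PrimeSpectrum R) ∈ Module.support R X := by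
    rw [Module.mem_support_iff']
    refine ⟨x, fun r hr h0 => hr (hle (Submodule.mem_colon_singleton.2 ?_))⟩
    rw [← map_smul, h0, map_zero]
    exact Submodule.zero_mem _
  refine Order.krullDim_le_of_strictMono
    (fun q => ⟨q.1, Module.mem_support_mono (p := ⟨p, hp'⟩) ?_ hpX⟩) fun _ _ h => h
  have := Module.mem_support_iff_of_finite.1 q.2
  rwa [Ideal.annihilator_quotient] at this

theorem exists_isRegular_of_le_localDepth {M : Type v} [AddCommGroup M] [Module R M]
    [Nontrivial M] {n : ℕ} (h : (n : ℕ∞) ≤ localDepth R M) :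
    ∃ rs : List R, IsRegular M rs ∧ (∀ x ∈ rs, x ∈ maximalIdeal R) ∧ n ≤ rs.length := by
  by_contra! hcon
  cases n with
  | zero => exact absurd (hcon [] (IsRegular.nil R M) (by simp)) (by simp)
  | succ n =>
    have hle : localDepth R M ≤ n := iSup₂_le fun rs hrs =>
      Nat.cast_le.2 (Nat.lt_succ_iff.1 (hcon rs hrs.2 hrs.1))
    exact absurd (h.trans hle) (by norm_cast; omega)

/-- Over a Gorenstein local ring `R`, a Cohen-Macaulay module `X` with `Hom(X, R) ≠ 0` satisfies
`Ext^1(X, R) = 0`: maps from the kernel of a presentation `P → X` extend to `P`. -/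
theorem IsCohenMacaulayLocal.exists_extension (hR : IsGorensteinLocalRing R) {X : Type v}
    [AddCommGroup X] [Module R X] (hX : IsCohenMacaulayLocal R X) {f : X →ₗ[R] R} (hf : f ≠ 0)
    {P : Type u} [AddCommGroup P] [Module R P] (π : P →ₗ[R] X)
    (hπ : Function.Surjective π) (φ : LinearMap.ker π →ₗ[R] R) :
    ∃ ψ : P →ₗ[R] R, ψ ∘ₗ (LinearMap.ker π).subtype = φ := by
  have := hR.noetherian
  have := hX.finite
  obtain ⟨rs, hrs, hmem, hvanish⟩ := hR.exists_isRegular_subsingleton_ext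
  have hle := length_le_supportDim_of_exists_linearMap_ne_zero hf hrs.toIsWeaklyRegular hmem
  have hnt : Nontrivial X := by
    by_contra hcon
    rw [not_nontrivial_iff_subsingleton] at hcon
    exact hf (Subsingleton.elim _ _)
  rw [← hX.depth_eq.resolve_left (not_subsingleton X), WithBot.coe_le_coe] at hle
  obtain ⟨xs, hxs, hxmem, hlen⟩ := exists_isRegular_of_le_localDepth hle
  let e := π.quotKerEquivOfSurjective hπ
  have : Module.Finite R (P ⧸ LinearMap.ker π) := Module.Finite.equiv e.symm
  have hext : Subsingleton (Ext (ModuleCat.of R (P ⧸ LinearMap.ker π)) (ModuleCat.of R R) 1) :=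
    subsingleton_ext_of_isRegular (ModuleCat.of R R) rs.length hvanish xs _
      ((e.isWeaklyRegular_congr xs).2 hxs.toIsWeaklyRegular) hxmem 1 (by omega)
  let S : ShortComplex (ModuleCat.{u} R) :=
    ModuleCat.shortComplexOfCompEqZero (LinearMap.ker π).subtype (LinearMap.ker π).mkQ
      (by ext; simp)
  have hS : S.ShortExact := ModuleCat.shortComplex_shortExact S
    (LinearMap.exact_subtype_mkQ _) (Submodule.subtype_injective _) (Submodule.mkQ_surjective _)
  have : Subsingleton (Ext S.X₃ (ModuleCat.of R R) 1) := hext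
  obtain ⟨y, hy⟩ := Ext.contravariant_sequence_exact₁ hS (ModuleCat.of R R)
    (Ext.mk₀ (ModuleCat.ofHom φ : S.X₁ ⟶ ModuleCat.of R R)) (add_comm 1 0) (Subsingleton.elim _ _)
  obtain ⟨g, rfl⟩ := (Ext.mk₀_bijective _ _).2 y
  rw [Ext.mk₀_comp_mk₀] at hy
  have hg := (Ext.mk₀_bijective _ _).1 hy
  exact ⟨g.hom, congrArg ModuleCat.Hom.hom hg⟩

/-- A finite module of full dimension over a Noetherian local ring has a nonzero dual: otherwise its
annihilator contains a regular element. -/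
theorem exists_dual_ne_zero_of_supportDim_eq [IsNoetherianRing R] {M : Type v} [AddCommGroup M]
    [Module R M] [Module.Finite R M] (h : Module.supportDim R M = ringKrullDim R) :
    ∃ f : Module.Dual R M, f ≠ 0 := by
  by_contra! hcon
  have hsub : Subsingleton (M →ₗ[R] R) := subsingleton_of_forall_eq 0 hcon
  obtain ⟨r, hr, hreg⟩ := IsSMulRegular.subsingleton_linearMap_iff.1 hsub
  have hr0 : r ∈ nonZeroDivisors R := by
    rw [mem_nonZeroDivisors_iff_right]
    exact fun y hy => hreg.right_eq_zero_of_smul (by rwa [smul_eq_mul, mul_comm])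
  have hle : Module.supportDim R M ≤ ringKrullDim (R ⧸ Ideal.span {r}) := by
    rw [Module.supportDim_eq_ringKrullDim_quotient_annihilator]
    exact ringKrullDim_le_of_surjective
      (Ideal.Quotient.factor ((Ideal.span_singleton_le_iff_mem _).2 hr))
      (Ideal.Quotient.factor_surjective _)
  have hlt := ringKrullDim_quotient_succ_le_of_nonZeroDivisor hr0
  rw [h] at hle
  obtain ⟨d, hd⟩ := exists_ringKrullDim_eq_natCast R
  have := (add_le_add_left hle 1).trans hlt
  rw [hd] at this
  exact absurd this (by norm_cast; omega)

end Gorenstein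

/-! ### Extension of maps after localization -/

section Localization

/-- If `X` has a Cohen-Macaulay localization at a prime `p` with Gorenstein local ring and a map
`f : X → G` is nonzero at `p`, then maps into `G` from the kernel of a presentation `P → X` extend
to `P` after multiplication by an element outside `p`. -/
theorem exists_smul_eq_comp_of_isCohenMacaulayLocal {G : Type u} [CommRing G] [IsNoetherianRing G]
    (p : Ideal G) [p.IsPrime] (hG : IsGorensteinLocalRing (Localization.AtPrime p))
    {X : Type v} [AddCommGroup X] [Module G X] [Module.Finite G X]
    (hX : IsCohenMacaulayLocal (Localization.AtPrime p) (LocalizedModule p.primeCompl X))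
    {f : X →ₗ[G] G} (hf : ∀ s ∉ p, s • f ≠ 0)
    {P K : Type u} [AddCommGroup P] [Module G P] [Module.Finite G P] [AddCommGroup K] [Module G K]
    {π : P →ₗ[G] X} (hπ : Function.Surjective π) {ι : K →ₗ[G] P} (hι : Function.Injective ι)
    (hιπ : Function.Exact ι π) (ψ : K →ₗ[G] G) :
    ∃ s ∉ p, ∃ Ψ : P →ₗ[G] G, s • ψ = Ψ ∘ₗ ι := by
  have : Module.Finite G K := Module.Finite.of_injective ι hι
  have := Module.finitePresentation_of_finite G K
  have := Module.finitePresentation_of_finite G X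
  have := Module.finitePresentation_of_finite G P
  let S := p.primeCompl
  let L := Localization.AtPrime p
  let fX := IsLocalizedModule.mapExtendScalars S (LocalizedModule.mkLinearMap S X)
    (Algebra.linearMap G L) L
  let fP := IsLocalizedModule.mapExtendScalars S (LocalizedModule.mkLinearMap S P)
    (Algebra.linearMap G L) L
  let fK := IsLocalizedModule.mapExtendScalars S (LocalizedModule.mkLinearMap S K)
    (Algebra.linearMap G L) L
  have hf' : fX f ≠ 0 := by
    intro h0
    obtain ⟨c, hc⟩ := IsLocalizedModule.exists_of_eq (S := S) (f := fX) (h0.trans (map_zero fX).symm)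
    rw [smul_zero] at hc
    exact hf c.1 c.2 hc
  let ι' := LocalizedModule.map S ι
  let π' := LocalizedModule.map S π
  have hι' : Function.Injective ι' := LocalizedModule.map_injective S ι hι
  have hπ' : Function.Surjective π' := LocalizedModule.map_surjective S π hπ
  have hex : Function.Exact ι' π' := LocalizedModule.map_exact S ι π hιπ
  let e : LocalizedModule S K ≃ₗ[L] LinearMap.ker π' :=
    (LinearEquiv.ofInjective ι' hι').trans (LinearEquiv.ofEq _ _ hex.linearMap_ker_eq.symm)
  obtain ⟨Ψ', hΨ'⟩ := hX.exists_extension hG hf' π' hπ' (fK ψ ∘ₗ e.symm.toLinearMap)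
  have hΨι (k : LocalizedModule S K) : Ψ' (ι' k) = fK ψ k := by
    have := LinearMap.congr_fun hΨ' (e k)
    rw [LinearMap.comp_apply, LinearMap.comp_apply, LinearEquiv.coe_coe, e.symm_apply_apply] at this
    exact this
  obtain ⟨⟨Ψ, s⟩, hs⟩ := IsLocalizedModule.surj S fP Ψ'
  have hcomp : fK (s.1 • ψ) = fK (Ψ ∘ₗ ι) := by
    refine LinearMap.restrictScalars_injective G (IsLocalizedModule.linearMap_ext S
      (LocalizedModule.mkLinearMap S K) (Algebra.linearMap G L) (LinearMap.ext fun k => ?_))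
    have hK (χ : K →ₗ[G] G) : fK χ (LocalizedModule.mkLinearMap S K k) = algebraMap G L (χ k) :=
      IsLocalizedModule.map_apply S (LocalizedModule.mkLinearMap S K) (Algebra.linearMap G L) χ k
    have hP : fP Ψ (LocalizedModule.mkLinearMap S P (ι k)) = algebraMap G L (Ψ (ι k)) :=
      IsLocalizedModule.map_apply S (LocalizedModule.mkLinearMap S P) (Algebra.linearMap G L) Ψ _
    have hιk : ι' (LocalizedModule.mkLinearMap S K k) = LocalizedModule.mkLinearMap S P (ι k) :=
      LocalizedModule.map_mk S ι k 1
    change fK (s.1 • ψ) (LocalizedModule.mkLinearMap S K k) =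
      fK (Ψ ∘ₗ ι) (LocalizedModule.mkLinearMap S K k)
    rw [hK, hK, LinearMap.comp_apply, ← hP, ← hιk, ← hs, LinearMap.smul_apply, smul_eq_mul, map_mul,
      ← hK, ← hΨι]
    exact (Algebra.smul_def s.1 _).symm
  obtain ⟨c, hc⟩ := IsLocalizedModule.exists_of_eq (S := S) (f := fK) hcomp
  refine ⟨c.1 * s.1, (c * s).2, c.1 • Ψ, ?_⟩
  rw [mul_smul]
  exact hc.trans (LinearMap.smul_comp _ _ _).symm

end Localization

/-! ### Maps of associated graded modules -/

namespace IdealFiltration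

section pieces

variable {A : Type u} [CommRing A] {𝔞 : Ideal A} {M : Type v} [AddCommGroup M] [Module A M]
  {M' : Type w} [AddCommGroup M'] [Module A M'] (F : IdealFiltration 𝔞 M)
  (F' : IdealFiltration 𝔞 M')

theorem cls_add {n : ℤ} {x y : M} (hx : x ∈ F.N n) (hy : y ∈ F.N n) :
    F.cls n (x + y) (add_mem hx hy) = F.cls n x hx + F.cls n y hy := rfl

theorem cls_sub {n : ℤ} {x y : M} (hx : x ∈ F.N n) (hy : y ∈ F.N n) :
    F.cls n (x - y) (sub_mem hx hy) = F.cls n x hx - F.cls n y hy := rfl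

theorem cls_zero (n : ℤ) : F.cls n 0 (zero_mem _) = 0 := rfl

theorem cls_sum {ι : Type*} (s : Finset ι) {n : ℤ} (x : ι → M) (hx : ∀ i, x i ∈ F.N n) :
    F.cls n (∑ i ∈ s, x i) (sum_mem fun i _ => hx i) = ∑ i ∈ s, F.cls n (x i) (hx i) := by
  classical
  induction s using Finset.induction_on with
  | empty => simp [cls_zero]
  | insert i s hi ih =>
    simp only [Finset.sum_insert hi]
    rw [← ih]
    exact F.cls_add _ _

theorem cls_eq_cls_iff {n : ℤ} {x y : M} {hx : x ∈ F.N n} {hy : y ∈ F.N n} :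
    F.cls n x hx = F.cls n y hy ↔ x - y ∈ F.N (n + 1) := by
  rw [← sub_eq_zero, ← cls_sub, cls_eq_zero_iff]

theorem of_cls_congr {i j : ℤ} {x y : M} (hij : i = j) (hxy : x = y) (hx : x ∈ F.N i)
    (hy : y ∈ F.N j) :
    DirectSum.of F.piece i (F.cls i x hx) = DirectSum.of F.piece j (F.cls j y hy) := by
  subst hij
  subst hxy
  rfl

/-- An additive map on `M_n` that kills `M_{n+1}` factors through `M_n / M_{n+1}`. -/
def pieceLift {B : Type w} [AddCommGroup B] (n : ℤ) (φ : F.N n →+ B)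
    (h : ∀ x : F.N n, (x : M) ∈ F.N (n + 1) → φ x = 0) : F.piece n →+ B :=
  QuotientAddGroup.lift ((F.N (n + 1)).submoduleOf (F.N n)).toAddSubgroup φ
    fun x hx => h x hx

theorem pieceLift_cls {B : Type w} [AddCommGroup B] {n : ℤ} {φ : F.N n →+ B}
    (h : ∀ x : F.N n, (x : M) ∈ F.N (n + 1) → φ x = 0) {x : M} (hx : x ∈ F.N n) :
    F.pieceLift n φ h (F.cls n x hx) = φ ⟨x, hx⟩ := rfl

/-- The elements of the associated graded module are determined by their components, and may be
analysed one homogeneous class at a time. -/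
theorem gr_induction {p : gr F → Prop} (zero : p 0)
    (of : ∀ (n : ℤ) (x : M) (hx : x ∈ F.N n), p (DirectSum.of F.piece n (F.cls n x hx)))
    (add : ∀ x y, p x → p y → p (x + y)) (x : gr F) : p x := by
  refine DirectSum.induction_on x zero (fun n y => ?_) (fun x y => add x y)
  obtain ⟨x, hx, rfl⟩ := F.cls_surjective y
  exact of n x hx

theorem of_cls_smul_of_cls {i j : ℤ} {a : A} {x : M} (ha : a ∈ (adic 𝔞 A).N i)
    (hx : x ∈ F.N j) :
    (DirectSum.of (adic 𝔞 A).piece i ((adic 𝔞 A).cls i a ha) : grRing 𝔞) •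
        DirectSum.of F.piece j (F.cls j x hx) =
      DirectSum.of F.piece (i + j) (F.cls (i + j) (a • x) (F.smul_mem_add ha hx)) :=
  DirectSum.Gmodule.of_smul_of _ _ _ _

theorem of_cls_mul_of_cls {i j : ℤ} {a b : A} (ha : a ∈ (adic 𝔞 A).N i)
    (hb : b ∈ (adic 𝔞 A).N j) :
    (DirectSum.of (adic 𝔞 A).piece i ((adic 𝔞 A).cls i a ha) : grRing 𝔞) *
        DirectSum.of (adic 𝔞 A).piece j ((adic 𝔞 A).cls j b hb) =
      DirectSum.of (adic 𝔞 A).piece (i + j)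
        ((adic 𝔞 A).cls (i + j) (a * b) ((adic 𝔞 A).smul_mem_add ha hb)) :=
  DirectSum.of_mul_of _ _

/-- The component in degree `i + j` of the product of a homogeneous element of degree `i` with `x`
is determined by the component of `x` in degree `j`. -/
theorem of_cls_smul_apply {i j e : ℤ} (he : e = i + j) {a : A} (ha : a ∈ (adic 𝔞 A).N i)
    {x : gr F} {y : M} (hy : y ∈ F.N j) (hx : x j = F.cls j y hy)
    (hay : a • y ∈ F.N e) :
    ((DirectSum.of (adic 𝔞 A).piece i ((adic 𝔞 A).cls i a ha) : grRing 𝔞) • x) e =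
      F.cls e (a • y) hay := by
  subst he
  have key (x : gr F) :
      ((DirectSum.of (adic 𝔞 A).piece i ((adic 𝔞 A).cls i a ha) : grRing 𝔞) • x) (i + j) =
        F.smulPiece i j ((adic 𝔞 A).cls i a ha) (x j) := by
    induction x using F.gr_induction with
    | zero => rw [smul_zero, DirectSum.zero_apply, DirectSum.zero_apply, map_zero]
    | of n x hx =>
      rw [of_cls_smul_of_cls]
      by_cases hn : n = j
      · subst hn
        rw [DirectSum.of_eq_same, DirectSum.of_eq_same]
        rfl
      · rw [DirectSum.of_eq_of_ne _ _ _ (by omega), DirectSum.of_eq_of_ne _ _ _ (by omega), map_zero]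
    | add x y hx hy => rw [smul_add, DirectSum.add_apply, DirectSum.add_apply, hx, hy, map_add]
  rw [key, hx]
  rfl

/-- The component in degree `i + j` of the product of `r` with a homogeneous element of degree `j`
is determined by the component of `r` in degree `i`. -/
theorem smul_of_cls_apply {i j e : ℤ} (he : e = i + j) {r : grRing 𝔞} {a : A}
    (ha : a ∈ (adic 𝔞 A).N i) (hr : r i = (adic 𝔞 A).cls i a ha) {y : M} (hy : y ∈ F.N j)
    (hay : a • y ∈ F.N e) :
    (r • DirectSum.of F.piece j (F.cls j y hy)) e = F.cls e (a • y) hay := by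
  subst he
  have key (r : grRing 𝔞) :
      (r • DirectSum.of F.piece j (F.cls j y hy)) (i + j) =
        F.smulPiece i j (r i) (F.cls j y hy) := by
    induction r using (adic 𝔞 A).gr_induction with
    | zero =>
      rw [zero_smul, DirectSum.zero_apply, DirectSum.zero_apply, map_zero, LinearMap.zero_apply]
    | of n x hx =>
      rw [of_cls_smul_of_cls]
      by_cases hn : n = i
      · subst hn
        rw [DirectSum.of_eq_same, DirectSum.of_eq_same]
        rfl
      · rw [DirectSum.of_eq_of_ne _ _ _ (by omega), DirectSum.of_eq_of_ne _ _ _ (by omega),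
          map_zero, LinearMap.zero_apply]
    | add x y hx hy =>
      rw [add_smul, DirectSum.add_apply, DirectSum.add_apply, hx, hy, map_add, LinearMap.add_apply]
  rw [key, hr]
  rfl

end pieces

section grMap

variable {A : Type u} [CommRing A] {𝔞 : Ideal A} {M : Type v} [AddCommGroup M] [Module A M]
  {M' : Type w} [AddCommGroup M'] [Module A M'] (F : IdealFiltration 𝔞 M)
  (F' : IdealFiltration 𝔞 M')

/-- The `G_𝔞(A)`-linear maps between the associated graded modules of two filtrations. For the
`𝔞`-adic filtration of `A`, the module structure on the target is the one defined for an arbitrary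
filtration. -/
abbrev GrHom : Type (max v w) := gr F →ₗ[grRing 𝔞] gr F'

instance : Module (grRing 𝔞) (GrHom F F') := LinearMap.module

variable {F F'}

theorem grHom_smul_apply (r : grRing 𝔞) (φ : GrHom F F') (x : gr F) : (r • φ) x = r • φ x := rfl

theorem grHom_ext {φ ψ : GrHom F F'} (h : ∀ (j : ℤ) (x : M) (hx : x ∈ F.N j),
    φ (DirectSum.of F.piece j (F.cls j x hx)) = ψ (DirectSum.of F.piece j (F.cls j x hx))) :
    φ = ψ := by
  refine LinearMap.ext fun x => ?_
  induction x using F.gr_induction with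
  | zero => rw [map_zero, map_zero]
  | of n x hx => exact h n x hx
  | add x y hx hy => rw [map_add, map_add, hx, hy]

/-- The additive map underlying `grMap`. -/
def grAddMap (f : M →ₗ[A] M') (d : ℤ) (hf : ∀ j, ∀ x ∈ F.N j, f x ∈ F'.N (d + j)) :
    gr F →+ gr F' :=
  DirectSum.toAddMonoid fun j => F.pieceLift j
    ((DirectSum.of F'.piece (d + j)).comp
      (((((F'.N (d + j + 1)).submoduleOf (F'.N (d + j))).mkQ) ∘ₗ
        (f.restrict (hf j))).toAddMonoidHom))
    (fun x hx => by
      have h : F'.cls (d + j) (f x) (hf j x x.2) = 0 := by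
        rw [cls_eq_zero_iff, add_assoc]
        exact hf _ _ hx
      exact (congrArg (DirectSum.of F'.piece (d + j)) h).trans (map_zero _))

theorem grAddMap_of_cls {f : M →ₗ[A] M'} {d : ℤ} (hf : ∀ j, ∀ x ∈ F.N j, f x ∈ F'.N (d + j))
    {j : ℤ} {x : M} (hx : x ∈ F.N j) :
    grAddMap f d hf (DirectSum.of F.piece j (F.cls j x hx)) =
      DirectSum.of F'.piece (d + j) (F'.cls (d + j) (f x) (hf j x hx)) :=
  DirectSum.toAddMonoid_of _ _ _

/-- The map of associated graded modules induced by a map `f` with `f(M_j) ⊆ M'_{d+j}`, homogeneous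
of degree `d`. -/
def grMap (f : M →ₗ[A] M') (d : ℤ) (hf : ∀ j, ∀ x ∈ F.N j, f x ∈ F'.N (d + j)) : GrHom F F' where
  __ := grAddMap f d hf
  map_smul' r x := by
    change grAddMap f d hf (r • x) = r • grAddMap f d hf x
    induction r using (adic 𝔞 A).gr_induction with
    | zero => rw [zero_smul, zero_smul, map_zero]
    | add r s hr hs => rw [add_smul, add_smul, map_add, hr, hs]
    | of i a ha =>
      induction x using F.gr_induction with
      | zero => rw [smul_zero, map_zero, smul_zero]
      | add x y hx hy => rw [smul_add, map_add, map_add, smul_add, hx, hy]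
      | of j x hx =>
        rw [of_cls_smul_of_cls, grAddMap_of_cls, grAddMap_of_cls, of_cls_smul_of_cls]
        exact of_cls_congr _ (by ring) (map_smul f a x) _ _

theorem grMap_of_cls {f : M →ₗ[A] M'} {d : ℤ} (hf : ∀ j, ∀ x ∈ F.N j, f x ∈ F'.N (d + j)) {j : ℤ}
    {x : M} (hx : x ∈ F.N j) :
    grMap f d hf (DirectSum.of F.piece j (F.cls j x hx)) =
      DirectSum.of F'.piece (d + j) (F'.cls (d + j) (f x) (hf j x hx)) :=
  grAddMap_of_cls hf hx

/-- The component of `grMap f d x` in degree `d + j` is determined by the component of `x` in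
degree `j`. -/
theorem grMap_apply {f : M →ₗ[A] M'} {d : ℤ} (hf : ∀ j, ∀ x ∈ F.N j, f x ∈ F'.N (d + j)) {j e : ℤ}
    (he : e = d + j) {x : gr F} {y : M} (hy : y ∈ F.N j) (hx : x j = F.cls j y hy)
    (hfy : f y ∈ F'.N e) : grMap f d hf x e = F'.cls e (f y) hfy := by
  subst he
  -- subtracting the homogeneous component reduces to the case `x j = 0`
  have key (x : gr F) : ∀ (y : M) (hy : y ∈ F.N j), x j = F.cls j y hy →
      grMap f d hf x (d + j) = F'.cls (d + j) (f y) (hf j y hy) := by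
    induction x using F.gr_induction with
    | zero =>
      intro y hy h
      rw [DirectSum.zero_apply, eq_comm, cls_eq_zero_iff] at h
      rw [map_zero, DirectSum.zero_apply, eq_comm, cls_eq_zero_iff, add_assoc]
      exact hf _ _ h
    | of n x hx =>
      intro y hy h
      rw [grMap_of_cls]
      by_cases hn : n = j
      · subst hn
        rw [DirectSum.of_eq_same, cls_eq_cls_iff] at h
        rw [DirectSum.of_eq_same, cls_eq_cls_iff, ← map_sub, add_assoc]
        exact hf _ _ h
      · rw [DirectSum.of_eq_of_ne _ _ _ (by omega), eq_comm, cls_eq_zero_iff] at h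
        rw [DirectSum.of_eq_of_ne _ _ _ (by omega), eq_comm, cls_eq_zero_iff, add_assoc]
        exact hf _ _ h
    | add x x' ih ih' =>
      intro y hy h
      obtain ⟨z, hz, hxz⟩ := F.cls_surjective (x j)
      obtain ⟨z', hz', hxz'⟩ := F.cls_surjective (x' j)
      rw [DirectSum.add_apply, ← hxz, ← hxz', ← cls_add, cls_eq_cls_iff] at h
      rw [map_add, DirectSum.add_apply, ih z hz hxz.symm, ih' z' hz' hxz'.symm, ← cls_add,
        cls_eq_cls_iff, ← map_add, ← map_sub, add_assoc]
      exact hf _ _ h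
  exact key x y hy hx

theorem grMap_mem_starHomDegree {f : M →ₗ[A] M'} {d : ℤ}
    (hf : ∀ j, ∀ x ∈ F.N j, f x ∈ F'.N (d + j)) :
    grMap f d hf ∈ starHomDegree (adic 𝔞 A).piece F.piece F'.piece d := by
  intro j x
  obtain ⟨x, hx, rfl⟩ := F.cls_surjective x
  exact ⟨_, (grMap_of_cls hf hx).symm⟩

end grMap

/-! ### The natural map `Φ_M` -/

section dualMap

variable {A : Type u} [CommRing A] {𝔞 : Ideal A} {M : Type v} [AddCommGroup M] [Module A M]

/-- The additive map `M^*_n → *Hom(G_𝔞(M), G_𝔞(A))_n`, `f ↦ gr(f)`. -/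
def dualGrMap (n : ℤ) : (dual 𝔞 M).N n →+ GrHom (adic 𝔞 M) (adic 𝔞 A) where
  toFun f := grMap f.1 n fun _ _ hx => dual_apply_mem f.2 hx
  map_zero' := grHom_ext fun j x hx => by
    rw [grMap_of_cls]
    exact (congrArg _ (cls_eq_zero_iff _ |>.2 (zero_mem _))).trans (map_zero _)
  map_add' f g := grHom_ext fun j x hx => by
    rw [LinearMap.add_apply, grMap_of_cls, grMap_of_cls, grMap_of_cls, ← map_add]
    rfl

/-- The natural map `Φ_M : G(F, M^*) → Hom(G_𝔞(M), G_𝔞(A))` as an additive map. -/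
def dualAddMap : gr (dual 𝔞 M) →+ GrHom (adic 𝔞 M) (adic 𝔞 A) :=
  DirectSum.toAddMonoid fun n => (dual 𝔞 M).pieceLift n (dualGrMap n) fun f hf =>
    grHom_ext fun j x hx => by
      refine (grMap_of_cls _ hx).trans ?_
      rw [LinearMap.zero_apply, (cls_eq_zero_iff _).2, map_zero]
      rw [show n + j + 1 = n + 1 + j by ring]
      exact dual_apply_mem hf hx

theorem dualAddMap_of_cls {n : ℤ} {f : Module.Dual A M} (hf : f ∈ (dual 𝔞 M).N n) :
    dualAddMap (DirectSum.of (dual 𝔞 M).piece n ((dual 𝔞 M).cls n f hf)) =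
      grMap (F := adic 𝔞 M) (F' := adic 𝔞 A) f n fun _ _ hx => dual_apply_mem hf hx :=
  DirectSum.toAddMonoid_of _ _ _

/-- The natural map `Φ_M : G(F, M^*) → Hom(G_𝔞(M), G_𝔞(A))`. -/
def dualMap : gr (dual 𝔞 M) →ₗ[grRing 𝔞] GrHom (adic 𝔞 M) (adic 𝔞 A) where
  __ := dualAddMap
  map_smul' r x := by
    change dualAddMap (r • x) = r • dualAddMap x
    induction r using (adic 𝔞 A).gr_induction with
    | zero => rw [zero_smul, zero_smul, map_zero]
    | add r s hr hs => rw [add_smul, add_smul, map_add, hr, hs]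
    | of i a ha =>
      induction x using (dual 𝔞 M).gr_induction with
      | zero => rw [smul_zero, map_zero, smul_zero]
      | add x y hx hy => rw [smul_add, map_add, map_add, smul_add, hx, hy]
      | of j x hx =>
        rw [of_cls_smul_of_cls, dualAddMap_of_cls, dualAddMap_of_cls]
        refine grHom_ext fun k m hm => ?_
        rw [grHom_smul_apply, grMap_of_cls, grMap_of_cls, of_cls_smul_of_cls]
        exact of_cls_congr _ (by ring) rfl _ _

theorem dualMap_of_cls {n : ℤ} {f : Module.Dual A M} (hf : f ∈ (dual 𝔞 M).N n) :
    dualMap (DirectSum.of (dual 𝔞 M).piece n ((dual 𝔞 M).cls n f hf)) =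
      grMap (F := adic 𝔞 M) (F' := adic 𝔞 A) f n fun _ _ hx => dual_apply_mem hf hx :=
  dualAddMap_of_cls hf

theorem mem_adic_zero (m : M) : m ∈ (adic 𝔞 M).N 0 := by
  simp [adic]

theorem dualMap_apply_apply {n : ℤ} {x : gr (dual 𝔞 M)} {f : Module.Dual A M}
    (hf : f ∈ (dual 𝔞 M).N n) (hx : x n = (dual 𝔞 M).cls n f hf) (m : M) :
    dualMap x (DirectSum.of (adic 𝔞 M).piece 0 ((adic 𝔞 M).cls 0 m (mem_adic_zero m))) n =
      (adic 𝔞 A).cls n (f m) (mem_adic_self.2 (hf m)) := by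
  have key (x : gr (dual 𝔞 M)) : ∀ (f : Module.Dual A M) (hf : f ∈ (dual 𝔞 M).N n),
      x n = (dual 𝔞 M).cls n f hf →
      dualMap x (DirectSum.of (adic 𝔞 M).piece 0 ((adic 𝔞 M).cls 0 m (mem_adic_zero m))) n =
        (adic 𝔞 A).cls n (f m) (mem_adic_self.2 (hf m)) := by
    induction x using (dual 𝔞 M).gr_induction with
    | zero =>
      intro f hf h
      rw [DirectSum.zero_apply, eq_comm, cls_eq_zero_iff] at h
      rw [map_zero, LinearMap.zero_apply, DirectSum.zero_apply, eq_comm, cls_eq_zero_iff]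
      exact mem_adic_self.2 (h m)
    | of k g hg =>
      intro f hf h
      rw [dualMap_of_cls, grMap_of_cls]
      by_cases hk : k = n
      · subst hk
        rw [DirectSum.of_eq_same, cls_eq_cls_iff] at h
        rw [of_cls_congr (adic 𝔞 A) (add_zero k) rfl _ (mem_adic_self.2 (hg m)),
          DirectSum.of_eq_same, cls_eq_cls_iff]
        exact mem_adic_self.2 (h m)
      · rw [DirectSum.of_eq_of_ne _ _ _ (by omega), eq_comm, cls_eq_zero_iff] at h
        rw [DirectSum.of_eq_of_ne _ _ _ (by omega), eq_comm, cls_eq_zero_iff]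
        exact mem_adic_self.2 (h m)
    | add x x' ih ih' =>
      intro f hf h
      obtain ⟨z, hz, hxz⟩ := (dual 𝔞 M).cls_surjective (x n)
      obtain ⟨z', hz', hxz'⟩ := (dual 𝔞 M).cls_surjective (x' n)
      rw [DirectSum.add_apply, ← hxz, ← hxz', ← cls_add, cls_eq_cls_iff] at h
      rw [map_add, LinearMap.add_apply, DirectSum.add_apply, ih z hz hxz.symm,
        ih' z' hz' hxz'.symm, ← cls_add, cls_eq_cls_iff]
      exact mem_adic_self.2 (h m)
  exact key x f hf hx

/-- `Φ_M` is injective for every module: if `gr(f)` kills the degree-zero part of `G_𝔞(M)`, then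
`f(M) ⊆ 𝔞^{n+1}`. -/
theorem dualMap_injective : Function.Injective (dualMap (𝔞 := 𝔞) (M := M)) := by
  refine (injective_iff_map_eq_zero _).2 fun x hx => DFinsupp.ext fun n => ?_
  obtain ⟨f, hf, hxf⟩ := (dual 𝔞 M).cls_surjective (x n)
  rw [← hxf]
  refine (cls_eq_zero_iff _).2 fun m => ?_
  have h := dualMap_apply_apply hf hxf.symm m
  rw [hx, LinearMap.zero_apply, DirectSum.zero_apply, eq_comm, cls_eq_zero_iff] at h
  exact mem_adic_self.1 h

end dualMap

end IdealFiltration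

/-! ### The ring `G_𝔞(A)` and its graded maximal ideal -/

namespace IdealFiltration

section ring

variable {A : Type u} [CommRing A] {𝔞 : Ideal A} {M : Type v} [AddCommGroup M] [Module A M]

/-- The module structure of `G_𝔞(A)` as the associated graded module of the `𝔞`-adic filtration of
`A` agrees with the multiplication of the ring `G_𝔞(A)`. -/
theorem gmodule_smul_eq_mul (r x : grRing 𝔞) :
    (DirectSum.Gmodule.module (adic 𝔞 A).piece (adic 𝔞 A).piece).toSMul.smul r x = r * x := by
  let := (DirectSum.Gmodule.module (adic 𝔞 A).piece (adic 𝔞 A).piece)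
  change r • x = r * x
  induction r using (adic 𝔞 A).gr_induction with
  | zero => rw [zero_smul, zero_mul]
  | add r s hr hs =>
    rw [add_mul, ← hr, ← hs]
    exact @add_smul (grRing 𝔞) (grRing 𝔞) _ _ this r s x
  | of i a ha =>
    induction x using (adic 𝔞 A).gr_induction with
    | zero => rw [smul_zero, mul_zero]
    | add x y hx hy => rw [smul_add, mul_add, hx, hy]
    | of j b hb => exact (of_cls_smul_of_cls _ ha hb).trans (of_cls_mul_of_cls ha hb).symm

theorem of_cls_mul_apply {i j e : ℤ} (he : e = i + j) {a : A} (ha : a ∈ (adic 𝔞 A).N i)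
    {x : grRing 𝔞} {y : A} (hy : y ∈ (adic 𝔞 A).N j) (hx : x j = (adic 𝔞 A).cls j y hy)
    (hay : a * y ∈ (adic 𝔞 A).N e) :
    ((DirectSum.of (adic 𝔞 A).piece i ((adic 𝔞 A).cls i a ha) : grRing 𝔞) * x) e =
      (adic 𝔞 A).cls e (a * y) hay := by
  rw [← gmodule_smul_eq_mul]
  exact of_cls_smul_apply (adic 𝔞 A) he ha hy hx hay

theorem mul_of_cls_apply {i j e : ℤ} (he : e = i + j) {r : grRing 𝔞} {a : A}
    (ha : a ∈ (adic 𝔞 A).N i) (hr : r i = (adic 𝔞 A).cls i a ha) {y : A}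
    (hy : y ∈ (adic 𝔞 A).N j) (hay : a * y ∈ (adic 𝔞 A).N e) :
    (r * (DirectSum.of (adic 𝔞 A).piece j ((adic 𝔞 A).cls j y hy) : grRing 𝔞)) e =
      (adic 𝔞 A).cls e (a * y) hay := by
  rw [← gmodule_smul_eq_mul]
  exact smul_of_cls_apply (adic 𝔞 A) he ha hr hy hay

/-- A map into the associated graded module of the `𝔞`-adic filtration of `A`, seen as a map into
the ring `G_𝔞(A)`. -/
def toRing {F : IdealFiltration 𝔞 M} (φ : GrHom F (adic 𝔞 A)) : gr F →ₗ[grRing 𝔞] grRing 𝔞 where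
  toFun := φ
  map_add' := map_add φ
  map_smul' r x := (φ.map_smul r x).trans (gmodule_smul_eq_mul r (φ x))

theorem toRing_apply {F : IdealFiltration 𝔞 M} (φ : GrHom F (adic 𝔞 A)) (x : gr F) :
    toRing φ x = φ x := rfl

theorem subsingleton_grRing_top : Subsingleton (grRing (⊤ : Ideal A)) := by
  refine subsingleton_of_forall_eq 0 fun x => DFinsupp.ext fun n => ?_
  obtain ⟨y, hy, h⟩ := (adic (⊤ : Ideal A) A).cls_surjective (x n)
  rw [← h]
  refine (cls_eq_zero_iff _).2 (mem_adic_self.2 ?_)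
  rw [Ideal.top_pow]
  trivial

section residue

variable [IsLocalRing A]

open IsLocalRing

/-- The component in degree `n` of `grResidue`. -/
noncomputable def grResiduePiece (h𝔞 : 𝔞 ≤ maximalIdeal A) (n : ℤ) :
    (adic 𝔞 A).piece n →+ ResidueField A :=
  (adic 𝔞 A).pieceLift n
    (if 0 ≤ n then (residue A).toAddMonoidHom.comp ((adic 𝔞 A).N n).subtype.toAddMonoidHom else 0)
    (fun x hx => by
      split_ifs with hn
      · exact (residue_eq_zero_iff _).2 (h𝔞 (Ideal.pow_le_self (by omega) (mem_adic_self.1 hx)))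
      · rfl)

theorem grResiduePiece_zero (h𝔞 : 𝔞 ≤ maximalIdeal A) {a : A} (ha : a ∈ (adic 𝔞 A).N 0) :
    grResiduePiece h𝔞 0 ((adic 𝔞 A).cls 0 a ha) = residue A a := rfl

theorem grResiduePiece_of_ne (h𝔞 : 𝔞 ≤ maximalIdeal A) {n : ℤ} (hn : n ≠ 0)
    (y : (adic 𝔞 A).piece n) : grResiduePiece h𝔞 n y = 0 := by
  obtain hn' | hn' := lt_or_gt_of_ne hn
  · have := subsingleton_piece_adic (𝔞 := 𝔞) (M := A) hn'
    rw [Subsingleton.elim y 0, map_zero]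
  · obtain ⟨a, ha, rfl⟩ := (adic 𝔞 A).cls_surjective y
    rw [grResiduePiece, pieceLift_cls, if_pos hn'.le]
    exact (residue_eq_zero_iff _).2 (h𝔞 (Ideal.pow_le_self (by omega) (mem_adic_self.1 ha)))

/-- The map `G_𝔞(A) → A/𝔪` for a proper ideal `𝔞` of a local ring: the projection to
`A/𝔞` followed by the residue map. Its kernel is the graded maximal ideal. -/
noncomputable def grResidue (h𝔞 : 𝔞 ≤ maximalIdeal A) : grRing 𝔞 →+* ResidueField A :=
  DirectSum.toSemiring (grResiduePiece h𝔞) (map_one (residue A)) <| by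
    intro i j x y
    by_cases hi : i = 0
    · by_cases hj : j = 0
      · subst hi hj
        obtain ⟨a, ha, rfl⟩ := (adic 𝔞 A).cls_surjective x
        obtain ⟨b, hb, rfl⟩ := (adic 𝔞 A).cls_surjective y
        exact map_mul (residue A) a b
      · rw [grResiduePiece_of_ne h𝔞 hj, mul_zero, grResiduePiece_of_ne h𝔞 (by omega)]
    · rw [grResiduePiece_of_ne h𝔞 hi, zero_mul]
      by_cases hij : i + j = 0
      · -- one of the two degrees is negative
        obtain hi' | hj' : i < 0 ∨ j < 0 := by omega
        · have := subsingleton_piece_adic (𝔞 := 𝔞) (M := A) hi'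
          rw [Subsingleton.elim x 0, DirectSum.GNonUnitalNonAssocSemiring.zero_mul, map_zero]
        · have := subsingleton_piece_adic (𝔞 := 𝔞) (M := A) hj'
          rw [Subsingleton.elim y 0, DirectSum.GNonUnitalNonAssocSemiring.mul_zero, map_zero]
      · exact grResiduePiece_of_ne h𝔞 hij _

theorem grResidue_eq (h𝔞 : 𝔞 ≤ maximalIdeal A) {s : grRing 𝔞} {a : A}
    (hs : s 0 = (adic 𝔞 A).cls 0 a (int_mem_adic 𝔞 a)) : grResidue h𝔞 s = residue A a := by
  have key (s : grRing 𝔞) : grResidue h𝔞 s = grResiduePiece h𝔞 0 (s 0) := by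
    induction s using (adic 𝔞 A).gr_induction with
    | zero => rw [map_zero, DirectSum.zero_apply, map_zero]
    | add s t hs ht => rw [map_add, DirectSum.add_apply, map_add, hs, ht]
    | of n b hb =>
      refine (DirectSum.toSemiring_of _ _ _ _ _).trans ?_
      by_cases hn : n = 0
      · subst hn
        rw [DirectSum.of_eq_same]
      · rw [DirectSum.of_eq_of_ne _ _ _ (by omega), map_zero, grResiduePiece_of_ne h𝔞 hn]
  rw [key, hs, grResiduePiece_zero]

theorem grResidue_surjective (h𝔞 : 𝔞 ≤ maximalIdeal A) : Function.Surjective (grResidue h𝔞) := by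
  intro y
  obtain ⟨a, rfl⟩ := residue_surjective y
  exact ⟨DirectSum.of (adic 𝔞 A).piece 0 ((adic 𝔞 A).cls 0 a (int_mem_adic 𝔞 a)),
    grResidue_eq h𝔞 (DirectSum.of_eq_same _ _)⟩

/-- An element outside the graded maximal ideal has a unit as its component of degree zero. -/
theorem exists_isUnit_of_grResidue_ne_zero (h𝔞 : 𝔞 ≤ maximalIdeal A) {s : grRing 𝔞}
    (hs : s ∉ RingHom.ker (grResidue h𝔞)) :
    ∃ a : A, IsUnit a ∧ s 0 = (adic 𝔞 A).cls 0 a (int_mem_adic 𝔞 a) := by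
  obtain ⟨a, ha, h⟩ := (adic 𝔞 A).cls_surjective (s 0)
  refine ⟨a, ?_, h.symm⟩
  rwa [RingHom.mem_ker, grResidue_eq h𝔞 h.symm, ← Ne, residue_ne_zero_iff_isUnit] at hs

end residue

end ring

/-! ### Presentations of `G_𝔞(M)` -/

section presentation

variable {A : Type u} [CommRing A] {𝔞 : Ideal A} {M : Type v} [AddCommGroup M] [Module A M]
  {ι : Type}

variable (𝔞) in
/-- The filtration induced on a submodule `N` of `A^ι` by the `𝔞`-adic filtration of `A^ι`. -/
def coordFiltration (N : Submodule A (ι → A)) : IdealFiltration 𝔞 N where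
  N j :=
    { carrier := {a | ∀ i, (a : ι → A) i ∈ 𝔞 ^ j.toNat}
      add_mem' := fun ha hb i => add_mem (ha i) (hb i)
      zero_mem' := fun _ => zero_mem _
      smul_mem' := fun c _ ha i => Ideal.mul_mem_left _ c (ha i) }
  succ_le j := fun a ha i => Ideal.pow_le_pow_right (by omega) (ha i)
  smul_le j := Submodule.smul_le.2 fun c hc a ha i => by
    have h : c * (a : ι → A) i ∈ 𝔞 ^ (j.toNat + 1) := by
      rw [pow_succ']
      exact Ideal.mul_mem_mul hc (ha i)
    exact Ideal.pow_le_pow_right (by omega) h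
  eventually_top := ⟨0, fun n hn => by
    rw [eq_top_iff]
    intro a _ i
    simp [Int.toNat_of_nonpos hn]⟩

/-- The map `gr(N) → G_𝔞(A)^ι` induced by the inclusion of a submodule `N` of `A^ι`. -/
def coordMap (N : Submodule A (ι → A)) :
    gr (coordFiltration 𝔞 N) →ₗ[grRing 𝔞] (ι → grRing 𝔞) :=
  LinearMap.pi fun i => toRing (grMap (LinearMap.proj i ∘ₗ N.subtype) 0 fun j _ ha =>
    mem_adic_self.2 ((zero_add j).symm ▸ ha i))

theorem coordMap_apply {N : Submodule A (ι → A)} {k : gr (coordFiltration 𝔞 N)} {j : ℤ} {a : N}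
    (ha : a ∈ (coordFiltration 𝔞 N).N j) (hk : k j = (coordFiltration 𝔞 N).cls j a ha) (i : ι) :
    coordMap N k i j = (adic 𝔞 A).cls j ((a : ι → A) i) (mem_adic_self.2 (ha i)) :=
  grMap_apply _ (zero_add j).symm ha hk _

theorem coordMap_of_cls {N : Submodule A (ι → A)} {j : ℤ} {a : N}
    (ha : a ∈ (coordFiltration 𝔞 N).N j) (i : ι) :
    coordMap N (DirectSum.of (coordFiltration 𝔞 N).piece j
      ((coordFiltration 𝔞 N).cls j a ha)) i =
      DirectSum.of (adic 𝔞 A).piece j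
        ((adic 𝔞 A).cls j ((a : ι → A) i) (mem_adic_self.2 (ha i))) :=
  (grMap_of_cls _ ha).trans (of_cls_congr _ (zero_add j) rfl _ _)

theorem coordMap_injective (N : Submodule A (ι → A)) :
    Function.Injective (coordMap (𝔞 := 𝔞) N) := by
  refine (injective_iff_map_eq_zero _).2 fun k hk => DFinsupp.ext fun j => ?_
  obtain ⟨a, ha, h⟩ := (coordFiltration 𝔞 N).cls_surjective (k j)
  rw [← h]
  refine (cls_eq_zero_iff _).2 fun i => ?_
  have hi := coordMap_apply ha h.symm i
  rw [hk, Pi.zero_apply, DirectSum.zero_apply, eq_comm, cls_eq_zero_iff] at hi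
  exact mem_adic_self.1 hi

variable [Fintype ι]

variable (𝔞) in
/-- The map `G_𝔞(A)^ι → G_𝔞(M)` given by the classes in degree zero of elements `x i` of `M`. -/
noncomputable def genMap (x : ι → M) : (ι → grRing 𝔞) →ₗ[grRing 𝔞] grModule 𝔞 M :=
  Fintype.linearCombination (grRing 𝔞) fun i =>
    DirectSum.of (adic 𝔞 M).piece 0 ((adic 𝔞 M).cls 0 (x i) (mem_adic_zero _))

theorem sum_smul_mem_adic (x : ι → M) {j : ℤ} {a : ι → A} (ha : ∀ i, a i ∈ 𝔞 ^ j.toNat) :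
    ∑ i, a i • x i ∈ (adic 𝔞 M).N j :=
  sum_mem fun i _ => Submodule.smul_mem_smul (ha i) trivial

theorem genMap_apply (x : ι → M) {g : ι → grRing 𝔞} {j : ℤ} {a : ι → A}
    (ha : ∀ i, a i ∈ 𝔞 ^ j.toNat)
    (hg : ∀ i, g i j = (adic 𝔞 A).cls j (a i) (mem_adic_self.2 (ha i))) :
    genMap 𝔞 x g j = (adic 𝔞 M).cls j (∑ i, a i • x i) (sum_smul_mem_adic x ha) := by
  have hmem (i : ι) : a i • x i ∈ (adic 𝔞 M).N j := Submodule.smul_mem_smul (ha i) trivial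
  rw [cls_sum _ _ (fun i => a i • x i) hmem, genMap, Fintype.linearCombination_apply]
  refine (DFinsupp.finsetSum_apply _ _ _).trans (Finset.sum_congr rfl fun i _ => ?_)
  exact smul_of_cls_apply (adic 𝔞 M) (add_zero j).symm _ (hg i) _ _

theorem exists_sum_smul_of_mem_adic {x : ι → M} (hx : Submodule.span A (Set.range x) = ⊤) {j : ℤ}
    {m : M} (hm : m ∈ (adic 𝔞 M).N j) :
    ∃ a : ι → A, (∀ i, a i ∈ 𝔞 ^ j.toNat) ∧ ∑ i, a i • x i = m := by
  have hm' : m ∈ 𝔞 ^ j.toNat • Submodule.span A (Set.range x) := hx ▸ hm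
  obtain ⟨a, ha, rfl⟩ := (Submodule.mem_ideal_smul_span_iff_exists_sum _ x m).1 hm'
  exact ⟨a, ha, (Finsupp.sum_fintype a (fun i c => c • x i) fun i => zero_smul A (x i)).symm⟩

theorem genMap_surjective {x : ι → M} (hx : Submodule.span A (Set.range x) = ⊤) :
    Function.Surjective (genMap 𝔞 x) := by
  classical
  rw [← LinearMap.range_eq_top, eq_top_iff]
  intro y _
  induction y using (adic 𝔞 M).gr_induction with
  | zero => exact zero_mem _
  | add y z hy hz => exact add_mem (hy trivial) (hz trivial)
  | of j m hm =>
    obtain ⟨a, ha, rfl⟩ := exists_sum_smul_of_mem_adic hx hm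
    have hmem (i : ι) : a i • x i ∈ (adic 𝔞 M).N j := Submodule.smul_mem_smul (ha i) trivial
    refine ⟨fun i => DirectSum.of (adic 𝔞 A).piece j
      ((adic 𝔞 A).cls j (a i) (mem_adic_self.2 (ha i))), ?_⟩
    rw [genMap, Fintype.linearCombination_apply, cls_sum _ _ (fun i => a i • x i) hmem, map_sum]
    refine Finset.sum_congr rfl fun i _ => ?_
    rw [of_cls_smul_of_cls]
    exact of_cls_congr _ (add_zero j) rfl _ _

/-- For generators `x` of `M` with module of relations `N`, the sequence
`gr(N) → G_𝔞(A)^ι → G_𝔞(M)` is exact: a homogeneous relation between the classes of the `x i` lifts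
to a relation between the `x i`. -/
theorem exact_coordMap_genMap {x : ι → M} (hx : Submodule.span A (Set.range x) = ⊤) :
    Function.Exact (coordMap (𝔞 := 𝔞) (LinearMap.ker (Fintype.linearCombination A x)))
      (genMap 𝔞 x) := by
  classical
  let N := LinearMap.ker (Fintype.linearCombination A x)
  intro g
  constructor
  · intro hg
    -- lift each homogeneous component of `g` to a relation with coefficients in `𝔞^j`
    have hlift (j : ℤ) : ∃ (a : N) (ha : a ∈ (coordFiltration 𝔞 N).N j), ∀ i,
        g i j = (adic 𝔞 A).cls j ((a : ι → A) i) (mem_adic_self.2 (ha i)) := by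
      choose a ha hag using fun i => (adic 𝔞 A).cls_surjective (g i j)
      have ha' : ∀ i, a i ∈ 𝔞 ^ j.toNat := fun i => mem_adic_self.1 (ha i)
      have h := genMap_apply x ha' fun i => (hag i).symm
      rw [hg, DirectSum.zero_apply, eq_comm, cls_eq_zero_iff] at h
      obtain ⟨b, hb, hab⟩ := exists_sum_smul_of_mem_adic hx h
      have hb' (i : ι) : b i ∈ 𝔞 ^ j.toNat := Ideal.pow_le_pow_right (by omega) (hb i)
      refine ⟨⟨a - b, ?_⟩, fun i => sub_mem (ha' i) (hb' i), fun i => ?_⟩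
      · rw [LinearMap.mem_ker, map_sub, Fintype.linearCombination_apply,
          Fintype.linearCombination_apply, hab, sub_self]
      · rw [← hag i, cls_eq_cls_iff]
        simpa using mem_adic_self.2 (hb i)
    choose a ha hag using hlift
    let s : Finset ℤ := Finset.univ.biUnion fun i => DFinsupp.support (g i)
    refine ⟨DirectSum.mk _ s fun j => (coordFiltration 𝔞 N).cls j (a j) (ha j), ?_⟩
    refine funext fun i => DFinsupp.ext fun j => ?_
    by_cases hj : j ∈ s
    · rw [hag j i]
      exact coordMap_apply (ha j) (DirectSum.mk_apply_of_mem hj) i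
    · have hgj : g i j = 0 := by
        by_contra hne
        exact hj (Finset.mem_biUnion.2 ⟨i, Finset.mem_univ _, DFinsupp.mem_support_iff.2 hne⟩)
      rw [hgj]
      exact coordMap_apply (zero_mem _) (DirectSum.mk_apply_of_notMem hj) i
  · rintro ⟨k, rfl⟩
    refine DFinsupp.ext fun j => ?_
    obtain ⟨a, ha, h⟩ := (coordFiltration 𝔞 N).cls_surjective (k j)
    refine (genMap_apply x ha fun i => coordMap_apply ha h.symm i).trans ?_
    exact (cls_eq_zero_iff _).2 (by
      have h0 : ∑ i, (a : ι → A) i • x i = 0 := a.2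
      rw [h0]
      exact zero_mem _)

end presentation

end IdealFiltration

/-! ### Lifting homogeneous maps -/

namespace IdealFiltration

section lifting

open IsLocalRing

variable {A : Type u} [CommRing A] [IsLocalRing A] {𝔞 : Ideal A}
  {M : Type v} [AddCommGroup M] [Module A M] {ι : Type} [Fintype ι]

/-- A nonzero functional `f : M → A` lies in a last term of the dual filtration, by Krull's
intersection theorem. -/
theorem exists_mem_dual_notMem_succ [IsNoetherianRing A] (h𝔞 : 𝔞 ≤ maximalIdeal A) {f : Module.Dual A M}
    (hf : f ≠ 0) : ∃ n : ℤ, f ∈ (dual 𝔞 M).N n ∧ f ∉ (dual 𝔞 M).N (n + 1) := by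
  by_contra! hcon
  have hall : ∀ n : ℕ, f ∈ (dual 𝔞 M).N n := by
    intro n
    induction n with
    | zero => intro m; simp
    | succ n ih => exact_mod_cast hcon n ih
  refine hf (LinearMap.ext fun m => ?_)
  have hmem : f m ∈ ⨅ n : ℕ, 𝔞 ^ n := (Submodule.mem_iInf _).2 fun n => hall n m
  rw [Ideal.iInf_pow_eq_bot_of_isLocalRing 𝔞
    (h𝔞.trans_lt (lt_top_iff_ne_top.2 (maximalIdeal.isMaximal A).ne_top)).ne] at hmem
  exact hmem

/-- If `f ∈ M^*_n` is not in `M^*_{n+1}`, then `gr(f)` is nonzero at the graded maximal ideal: an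
element outside that ideal has a unit in degree zero. -/
theorem smul_toRing_grMap_ne_zero (h𝔞 : 𝔞 ≤ maximalIdeal A) {n : ℤ} {f : Module.Dual A M}
    (hf : f ∈ (dual 𝔞 M).N n) (hf' : f ∉ (dual 𝔞 M).N (n + 1)) {s : grRing 𝔞}
    (hs : s ∉ RingHom.ker (grResidue h𝔞)) :
    s • toRing (grMap (F := adic 𝔞 M) (F' := adic 𝔞 A) f n fun _ _ hx => dual_apply_mem hf hx) ≠
      0 := by
  intro h0
  obtain ⟨u, hu, hsu⟩ := exists_isUnit_of_grResidue_ne_zero h𝔞 hs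
  refine hf' fun m => ?_
  have h := congrArg (fun y : grRing 𝔞 => y (n + 0)) (LinearMap.congr_fun h0
    (DirectSum.of (adic 𝔞 M).piece 0 ((adic 𝔞 M).cls 0 m (mem_adic_zero m))))
  have hfm : f m ∈ (adic 𝔞 A).N (n + 0) := dual_apply_mem hf (mem_adic_zero m)
  dsimp only at h
  rw [LinearMap.smul_apply, toRing_apply, grMap_of_cls, smul_eq_mul,
    mul_of_cls_apply (zero_add _).symm _ hsu _ (Ideal.mul_mem_left _ u hfm), LinearMap.zero_apply,
    DirectSum.zero_apply, cls_eq_zero_iff, mem_adic_self, add_zero] at h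
  exact (Ideal.unit_mul_mem_iff_mem _ hu).1 h

variable [IsNoetherianRing A]

/-- The vanishing of `Ext^1(G_𝔞(M), G_𝔞(A))` at the graded maximal ideal in terms of lifts: if a
functional `g` on `A^ι` maps relations with coefficients in `𝔞^j` into `𝔞^{d+j}` for all `j`, then
modifying `g` by a functional with coefficients in `𝔞^d` improves `d` to `d + 1`. -/
theorem exists_correction (h𝔞 : 𝔞 ≤ maximalIdeal A) (hG : IsGorensteinRing (grRing 𝔞))
    (hGM : IsCohenMacaulayModule (grRing 𝔞) (grModule 𝔞 M)) {f₀ : Module.Dual A M} (hf₀ : f₀ ≠ 0)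
    {x : ι → M} (hx : Submodule.span A (Set.range x) = ⊤) (c : ι → A) (d : ℤ)
    (hc : ∀ (j : ℤ) (a : ι → A), ∑ i, a i • x i = 0 → (∀ i, a i ∈ 𝔞 ^ j.toNat) →
      ∑ i, a i * c i ∈ 𝔞 ^ (d + j).toNat) :
    ∃ b : ι → A, (∀ i, b i ∈ 𝔞 ^ d.toNat) ∧ ∀ (j : ℤ) (a : ι → A), ∑ i, a i • x i = 0 →
      (∀ i, a i ∈ 𝔞 ^ j.toNat) → ∑ i, a i * (c i - b i) ∈ 𝔞 ^ (d + j + 1).toNat := by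
  classical
  have := hG.noetherian
  have := hGM.finite
  let p : Ideal (grRing 𝔞) := RingHom.ker (grResidue h𝔞)
  have hp : p.IsMaximal :=
    RingHom.ker_isMaximal_of_surjective (grResidue h𝔞) (grResidue_surjective h𝔞)
  obtain ⟨n, hn, hn'⟩ := exists_mem_dual_notMem_succ h𝔞 hf₀
  let N := LinearMap.ker (Fintype.linearCombination A x)
  have hN (a : N) : ∑ i, (a : ι → A) i • x i = 0 := a.2
  let g : N →ₗ[A] A := Fintype.linearCombination A c ∘ₗ N.subtype
  have hg : ∀ j, ∀ a ∈ (coordFiltration 𝔞 N).N j, g a ∈ (adic 𝔞 A).N (d + j) := fun j a ha =>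
    mem_adic_self.2 (hc j a (hN a) ha)
  obtain ⟨s, hs, Ψ, hΨ⟩ := exists_smul_eq_comp_of_isCohenMacaulayLocal p (hG.localization p)
    (hGM.localization p) (fun s hs => smul_toRing_grMap_ne_zero h𝔞 hn hn' hs)
    (genMap_surjective hx) (coordMap_injective (𝔞 := 𝔞) N) (exact_coordMap_genMap hx)
    (toRing (grMap g d hg))
  obtain ⟨u, hu, hsu⟩ := exists_isUnit_of_grResidue_ne_zero h𝔞 hs
  obtain ⟨u, rfl⟩ := hu
  -- the degree `d` components of the coefficients of `Ψ`, divided by the unit `u`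
  choose b hb hbΨ using fun i => (adic 𝔞 A).cls_surjective 
    (Ψ (fun k => if i = k then 1 else 0) d)
  refine ⟨fun i => ↑u⁻¹ * b i, fun i => Ideal.mul_mem_left _ _ (mem_adic_self.1 (hb i)),
    fun j a hax ha => ?_⟩
  let a' : N := ⟨a, hax⟩
  have ha' : a' ∈ (coordFiltration 𝔞 N).N j := ha
  have hga := hg j a' ha'
  have h := congrArg (fun y : grRing 𝔞 => y (d + j)) (LinearMap.congr_fun hΨ
    (DirectSum.of (coordFiltration 𝔞 N).piece j ((coordFiltration 𝔞 N).cls j a' ha')))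
  have hab (i : ι) : a i * b i ∈ (adic 𝔞 A).N (d + j) := by
    rw [add_comm]
    exact (adic 𝔞 A).smul_mem_add (mem_adic_self.2 (ha i)) (hb i)
  have hright : Ψ (coordMap N (DirectSum.of (coordFiltration 𝔞 N).piece j
      ((coordFiltration 𝔞 N).cls j a' ha'))) (d + j) =
      (adic 𝔞 A).cls (d + j) (∑ i, a i * b i) (sum_mem fun i _ => hab i) := by
    rw [LinearMap.pi_apply_eq_sum_univ Ψ, cls_sum _ _ _ hab]
    refine (DFinsupp.finsetSum_apply _ _ _).trans (Finset.sum_congr rfl fun i _ => ?_)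
    rw [coordMap_of_cls, smul_eq_mul]
    exact of_cls_mul_apply (add_comm d j) _ (hb i) (hbΨ i).symm _
  dsimp only at h
  rw [LinearMap.comp_apply, hright, LinearMap.smul_apply, toRing_apply, grMap_of_cls, smul_eq_mul,
    mul_of_cls_apply (zero_add _).symm _ hsu _ (Ideal.mul_mem_left _ _ hga), cls_eq_cls_iff,
    mem_adic_self] at h
  have hgoal : ∑ i, a i * (c i - ↑u⁻¹ * b i) = ↑u⁻¹ * (↑u * g a' - ∑ i, a i * b i) := by
    have hga' : g a' = ∑ i, a i * c i := rfl
    rw [hga', mul_sub, Units.inv_mul_cancel_left, Finset.mul_sum, ← Finset.sum_sub_distrib]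
    exact Finset.sum_congr rfl fun i _ => by ring
  rw [hgoal]
  exact Ideal.mul_mem_left _ _ h

/-- Successive corrections, followed by Krull's intersection theorem: a functional on `A^ι` that
raises the order of every relation by at least `d` agrees modulo `𝔞^d` with a functional that
vanishes on all relations. -/
theorem exists_functional (h𝔞 : 𝔞 ≤ maximalIdeal A) (hG : IsGorensteinRing (grRing 𝔞))
    (hGM : IsCohenMacaulayModule (grRing 𝔞) (grModule 𝔞 M)) {f₀ : Module.Dual A M} (hf₀ : f₀ ≠ 0)
    {x : ι → M} (hx : Submodule.span A (Set.range x) = ⊤) (c : ι → A) (d : ℤ)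
    (hc : ∀ (j : ℤ) (a : ι → A), ∑ i, a i • x i = 0 → (∀ i, a i ∈ 𝔞 ^ j.toNat) →
      ∑ i, a i * c i ∈ 𝔞 ^ (d + j).toNat) :
    ∃ c' : ι → A, (∀ i, c i - c' i ∈ 𝔞 ^ d.toNat) ∧
      ∀ a : ι → A, ∑ i, a i • x i = 0 → ∑ i, a i * c' i = 0 := by
  have happrox : ∀ s : ℕ, ∃ c' : ι → A, (∀ i, c i - c' i ∈ 𝔞 ^ d.toNat) ∧
      ∀ (j : ℤ) (a : ι → A), ∑ i, a i • x i = 0 → (∀ i, a i ∈ 𝔞 ^ j.toNat) →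
        ∑ i, a i * c' i ∈ 𝔞 ^ (d + s + j).toNat := by
    intro s
    induction s with
    | zero => exact ⟨c, fun i => by simp, fun j a h h' => by simpa using hc j a h h'⟩
    | succ s ih =>
      obtain ⟨c', hcc', hc'⟩ := ih
      obtain ⟨b, hb, hbc⟩ := exists_correction h𝔞 hG hGM hf₀ hx c' (d + s) hc'
      refine ⟨fun i => c' i - b i, fun i => ?_, fun j a h h' => ?_⟩
      · rw [← sub_add]
        exact add_mem (hcc' i) (Ideal.pow_le_pow_right (by omega) (hb i))
      · have := hbc j a h h'
        rwa [show d + (s + 1 : ℕ) + j = d + s + j + 1 by push_cast; ring]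
  -- evaluate functionals at finitely many generators of the module of relations
  obtain ⟨t, r, hr⟩ := Submodule.fg_iff_exists_fin_generating_family.1
    (IsNoetherian.noetherian (LinearMap.ker (Fintype.linearCombination A x)))
  have hrx (l : Fin t) : ∑ i, r l i • x i = 0 := by
    have : r l ∈ LinearMap.ker (Fintype.linearCombination A x) := hr ▸ Submodule.subset_span ⟨l, rfl⟩
    exact this
  let T : (ι → A) →ₗ[A] (Fin t → A) := LinearMap.pi fun l => Fintype.linearCombination A (r l)
  have hT (c : ι → A) (l : Fin t) : T c l = ∑ i, r l i * c i := by
    simp [T, Fintype.linearCombination_apply, mul_comm]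
  let W : Submodule A (Fin t → A) :=
    (Submodule.pi Set.univ fun _ : ι => 𝔞 ^ d.toNat).map T
  have hmem : T c ∈ W := by
    have hinf : W.mkQ (T c) ∈ ⨅ s : ℕ, 𝔞 ^ s • (⊤ : Submodule A ((Fin t → A) ⧸ W)) := by
      refine (Submodule.mem_iInf _).2 fun s => ?_
      obtain ⟨c', hcc', hc'⟩ := happrox (s + (-d).toNat)
      have hW : W.mkQ (T c) = W.mkQ (T c') := by
        rw [← sub_eq_zero, ← map_sub, ← map_sub, Submodule.mkQ_apply, Submodule.Quotient.mk_eq_zero]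
        exact ⟨c - c', fun i _ => hcc' i, rfl⟩
      rw [hW, pi_eq_sum_univ' (T c'), map_sum]
      refine sum_mem fun l _ => ?_
      rw [map_smul]
      refine Submodule.smul_mem_smul ?_ trivial
      rw [hT]
      exact Ideal.pow_le_pow_right (by omega) (hc' 0 (r l) (hrx l) fun i => by simp)
    rw [Ideal.iInf_pow_smul_eq_bot_of_isLocalRing 𝔞
      (h𝔞.trans_lt (lt_top_iff_ne_top.2 (maximalIdeal.isMaximal A).ne_top)).ne] at hinf
    exact (Submodule.Quotient.mk_eq_zero W).1 hinf
  obtain ⟨b, hb, hbc⟩ := hmem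
  refine ⟨c - b, fun i => by simpa using hb i trivial, fun a ha => ?_⟩
  have hspan : a ∈ Submodule.span A (Set.range r) := hr.symm ▸ ha
  have hker : Submodule.span A (Set.range r) ≤
      LinearMap.ker (Fintype.linearCombination A (c - b)) := by
    rw [Submodule.span_le]
    rintro _ ⟨l, rfl⟩
    have := congrFun (show T (c - b) = 0 by rw [map_sub, hbc, sub_self]) l
    rw [hT] at this
    exact this
  exact hker hspan

/-- Every homogeneous map `G_𝔞(M) → G_𝔞(A)` of degree `n` is induced by a functional `f` on `M` with
`f(M) ⊆ 𝔞^n`. -/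
theorem exists_grMap_eq_of_mem_starHomDegree [Module.Finite A M] (hG : IsGorensteinRing (grRing 𝔞))
    (hGM : IsCohenMacaulayModule (grRing 𝔞) (grModule 𝔞 M)) {f₀ : Module.Dual A M} (hf₀ : f₀ ≠ 0)
    {n : ℤ} {φ : GrHom (adic 𝔞 M) (adic 𝔞 A)}
    (hφ : φ ∈ starHomDegree (adic 𝔞 A).piece (adic 𝔞 M).piece (adic 𝔞 A).piece n) :
    ∃ (f : Module.Dual A M) (hf : f ∈ (dual 𝔞 M).N n),
      φ = grMap (F := adic 𝔞 M) (F' := adic 𝔞 A) f n fun _ _ hx => dual_apply_mem hf hx := by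
  by_cases h𝔞' : 𝔞 = ⊤
  · subst h𝔞'
    have : Subsingleton (gr (adic (⊤ : Ideal A) A)) := subsingleton_grRing_top
    exact ⟨0, zero_mem _, LinearMap.ext fun x => Subsingleton.elim _ _⟩
  have h𝔞 := le_maximalIdeal h𝔞'
  obtain ⟨r, x, hx⟩ := Module.Finite.exists_fin (R := A) (M := M)
  -- lift the values of `φ` on the classes of the generators
  have hlift (i : Fin r) : ∃ (c : A) (hc : c ∈ (adic 𝔞 A).N n),
      φ (DirectSum.of (adic 𝔞 M).piece 0 ((adic 𝔞 M).cls 0 (x i) (mem_adic_zero _))) =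
        DirectSum.of (adic 𝔞 A).piece n ((adic 𝔞 A).cls n c hc) := by
    obtain ⟨y, hy⟩ := hφ 0 ((adic 𝔞 M).cls 0 (x i) (mem_adic_zero _))
    obtain ⟨c, hc, rfl⟩ := (adic 𝔞 A).cls_surjective y
    exact ⟨c, add_zero n ▸ hc, hy.symm.trans (of_cls_congr _ (add_zero n) rfl _ _)⟩
  choose c hc hφc using hlift
  have hac {j : ℤ} {a : Fin r → A} (ha : ∀ i, a i ∈ 𝔞 ^ j.toNat) (i : Fin r) :
      a i • c i ∈ (adic 𝔞 A).N (n + j) := by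
    rw [add_comm]
    exact (adic 𝔞 A).smul_mem_add (mem_adic_self.2 (ha i)) (hc i)
  have hφa {j : ℤ} {a : Fin r → A} (ha : ∀ i, a i ∈ 𝔞 ^ j.toNat) :
      φ (DirectSum.of (adic 𝔞 M).piece j
        ((adic 𝔞 M).cls j (∑ i, a i • x i) (sum_smul_mem_adic x ha))) =
      DirectSum.of (adic 𝔞 A).piece (n + j)
        ((adic 𝔞 A).cls (n + j) (∑ i, a i • c i) (sum_mem fun i _ => hac ha i)) := by
    have hmem (i : Fin r) : a i • x i ∈ (adic 𝔞 M).N j := Submodule.smul_mem_smul (ha i) trivial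
    rw [cls_sum _ _ _ hmem, cls_sum _ _ _ (hac ha), map_sum, map_sum, map_sum]
    refine Finset.sum_congr rfl fun i _ => ?_
    have h := φ.map_smul (DirectSum.of (adic 𝔞 A).piece j
      ((adic 𝔞 A).cls j (a i) (mem_adic_self.2 (ha i))))
      (DirectSum.of (adic 𝔞 M).piece 0 ((adic 𝔞 M).cls 0 (x i) (mem_adic_zero _)))
    rw [hφc] at h
    exact (congrArg φ ((of_cls_congr _ (add_zero j).symm rfl _ _).trans
      (of_cls_smul_of_cls _ _ _).symm)).trans (h.trans
        ((of_cls_smul_of_cls (adic 𝔞 A) _ (hc i)).trans (of_cls_congr _ (add_comm j n) rfl _ _)))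
  obtain ⟨c', hcc', hc'⟩ := exists_functional h𝔞 hG hGM hf₀ hx c (n + 1) fun j a hax ha => by
    have h := hφa ha
    rw [(cls_eq_zero_iff (adic 𝔞 M)).2 (by rw [hax]; exact zero_mem _), map_zero, map_zero] at h
    have h' := congrArg (fun y : gr (adic 𝔞 A) => y (n + j)) h
    dsimp only at h'
    rw [DirectSum.of_eq_same, DirectSum.zero_apply, eq_comm, cls_eq_zero_iff, mem_adic_self] at h'
    rwa [show n + 1 + j = n + j + 1 by ring]
  -- `c'` vanishes on the relations, hence defines a functional on `M`
  have hsurj : Function.Surjective (Fintype.linearCombination A x) := by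
    rw [← LinearMap.range_eq_top, Fintype.range_linearCombination, hx]
  let f : Module.Dual A M := ((LinearMap.ker (Fintype.linearCombination A x)).liftQ
    (Fintype.linearCombination A c') hc') ∘ₗ
      ((Fintype.linearCombination A x).quotKerEquivOfSurjective hsurj).symm.toLinearMap
  have hf (a : Fin r → A) : f (∑ i, a i • x i) = ∑ i, a i • c' i := by
    have h := LinearMap.quotKerEquivOfSurjective_symm_apply _ hsurj a
    rw [Fintype.linearCombination_apply] at h
    rw [LinearMap.comp_apply, LinearEquiv.coe_coe, h]
    exact Submodule.liftQ_apply _ _ _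
  have hc'n (i : Fin r) : c' i ∈ 𝔞 ^ n.toNat := by
    rw [← sub_sub_cancel (c i) (c' i)]
    exact sub_mem (mem_adic_self.1 (hc i)) (Ideal.pow_le_pow_right (by omega) (hcc' i))
  have hfn : f ∈ (dual 𝔞 M).N n := by
    intro m
    obtain ⟨a, rfl⟩ := hsurj m
    rw [Fintype.linearCombination_apply, hf]
    exact sum_mem fun i _ => Ideal.mul_mem_left _ _ (hc'n i)
  refine ⟨f, hfn, grHom_ext fun j m hm => ?_⟩
  obtain ⟨a, ha, rfl⟩ := exists_sum_smul_of_mem_adic hx hm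
  rw [hφa ha, grMap_of_cls]
  refine congrArg _ ((cls_eq_cls_iff _).2 ?_)
  rw [hf, ← Finset.sum_sub_distrib]
  refine sum_mem fun i _ => ?_
  rw [← smul_sub, show n + j + 1 = j + (n + 1) by ring]
  exact (adic 𝔞 A).smul_mem_add (mem_adic_self.2 (ha i)) (mem_adic_self.2 (hcc' i))

end lifting

end IdealFiltration

theorem mainTheorem8 {A : Type u} [CommRing A] [IsLocalRing A]
    (hA : IsGorensteinLocalRing A) (𝔞 : Ideal A) (hG : IsGorensteinRing (grRing 𝔞))
    (M : Type v) [AddCommGroup M] [Module A M] (hM : IsMaximalCohenMacaulayLocal A M)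
    (hGM : IsCohenMacaulayModule (grRing 𝔞) (grModule 𝔞 M)) :
    ∃ e : gr (dual 𝔞 M) ≃ₗ[grRing 𝔞]
        starHom (adic 𝔞 A).piece (adic 𝔞 M).piece (adic 𝔞 A).piece,
      (∀ (n : ℤ) (x : gr (dual 𝔞 M)),
        x ∈ (DirectSum.of (dual 𝔞 M).piece n).range ↔
          (e x).1 ∈ starHomDegree (adic 𝔞 A).piece (adic 𝔞 M).piece (adic 𝔞 A).piece n) ∧
      (∀ (n j : ℤ) (f : Module.Dual A M) (hf : f ∈ (dual 𝔞 M).N n)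
        (m : M) (hm : m ∈ (adic 𝔞 M).N j),
        (e (DirectSum.of (dual 𝔞 M).piece n ((dual 𝔞 M).cls n f hf))).1
            (DirectSum.of (adic 𝔞 M).piece j ((adic 𝔞 M).cls j m hm)) =
          DirectSum.of (adic 𝔞 A).piece (n + j)
            ((adic 𝔞 A).cls (n + j) (f m) (dual_apply_mem hf hm))) := by
  have := hA.noetherian
  have := hM.isCohenMacaulay.finite
  obtain ⟨f₀, hf₀⟩ := exists_dual_ne_zero_of_supportDim_eq hM.dim_eq
  have hmem (x : gr (dual 𝔞 M)) :
      dualMap x ∈ starHom (adic 𝔞 A).piece (adic 𝔞 M).piece (adic 𝔞 A).piece := by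
    induction x using (dual 𝔞 M).gr_induction with
    | zero => rw [map_zero]; exact zero_mem _
    | add x y hx hy => rw [map_add]; exact add_mem hx hy
    | of n f hf =>
      rw [dualMap_of_cls]
      exact AddSubgroup.mem_iSup_of_mem n (grMap_mem_starHomDegree _)
  have hdeg {n : ℤ} {φ : GrHom (adic 𝔞 M) (adic 𝔞 A)}
      (hφ : φ ∈ starHomDegree (adic 𝔞 A).piece (adic 𝔞 M).piece (adic 𝔞 A).piece n) :
      ∃ y, dualMap (DirectSum.of (dual 𝔞 M).piece n y) = φ := by
    obtain ⟨f, hf, rfl⟩ := exists_grMap_eq_of_mem_starHomDegree hG hGM hf₀ hφ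
    exact ⟨_, dualMap_of_cls hf⟩
  have hsurj (φ : starHom (adic 𝔞 A).piece (adic 𝔞 M).piece (adic 𝔞 A).piece) :
      ∃ x, dualMap x = φ.1 := by
    have hle : (⨆ n : ℤ, starHomDegree (adic 𝔞 A).piece (adic 𝔞 M).piece (adic 𝔞 A).piece n) ≤
        (dualAddMap (𝔞 := 𝔞) (M := M)).range := by
      refine iSup_le fun n φ hφ => ?_
      obtain ⟨y, hy⟩ := hdeg hφ
      exact ⟨DirectSum.of (dual 𝔞 M).piece n y, hy⟩
    exact hle φ.2
  let Φ : gr (dual 𝔞 M) →ₗ[grRing 𝔞]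
      starHom (adic 𝔞 A).piece (adic 𝔞 M).piece (adic 𝔞 A).piece :=
    { toFun x := ⟨dualMap x, hmem x⟩
      map_add' x y := Subtype.ext (map_add dualMap x y)
      map_smul' r x := Subtype.ext (map_smul dualMap r x) }
  have hΦ : Function.Bijective Φ :=
    ⟨fun x y h => dualMap_injective (congrArg Subtype.val h),
      fun φ => (hsurj φ).imp fun x hx => Subtype.ext hx⟩
  refine ⟨LinearEquiv.ofBijective Φ hΦ, fun n x => ⟨?_, fun hx => ?_⟩, fun n j f hf m hm => ?_⟩
  · rintro ⟨y, rfl⟩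
    obtain ⟨f, hf, rfl⟩ := (dual 𝔞 M).cls_surjective y
    change dualMap _ ∈ _
    rw [dualMap_of_cls]
    exact grMap_mem_starHomDegree _
  · obtain ⟨y, hy⟩ := hdeg hx
    exact ⟨y, dualMap_injective hy⟩
  · change dualMap _ _ = _
    rw [dualMap_of_cls, grMap_of_cls]
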